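/- **Setting.** Let $k\ge 2$. A distribution-labeled $k$-graph $G=(\mathcal V,\mathcal E,N,(\mu_{\mathsf e})_{\mathsf e\in\mathcal E})$ consists of a finite vertex set $\mathcal V$, a finite multiset $\mathcal E$ of ordered $k$-tuples of distinct vertices, an integer $N\ge 1$, and for each $\mathsf e\in\mathcal E$ a probability distribution $\mu_{\mathsf e}$ on $\mathbb Z_N^k$ all of whose $k$ one-coordinate marginals are uniform on $\mathbb Z_N$. For $n\in\mathbb N$ and $\mathsf e=(\mathsf v_1,\dots,\mathsf v_k)\in\mathcal E$ put $U_i=\{\mathsf v_i\}\times[n]$ for $i=1,\dots,k$. Let $\Omega^{\mathsf e,d}$ be the set of labeled matchings with $d$ edges, that is, of maps $\mathbf y:U_1\times\dots\times U_k\to\mathbb Z_N^k\cup\{\mathtt{nil}\}$ whose support $\mathrm{supp}(\mathbf y)=\{e:\mathbf y(e)\ne\mathtt{nil}\}$ consists of $d$ pairwise vertex-disjoint tuples. Fix $\alpha\in(0,1)$ and an integer $K>0$, and let $m=\lfloor\alpha n\rfloor$. In the game $\mathsf{DIHP}(G,n,\alpha,K)$ each player $(\mathsf e,j)\in\mathcal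 E\times[K]$ receives an element of $\Omega^{\mathsf e,m}$, and $\mathcal D_{\mathrm{no}}$ is the uniform distribution on the space $\prod_{(\mathsf e,j)}\Omega^{\mathsf e,m}$ of joint inputs. An $r$-round protocol $\Pi$ is a deterministic protocol in which, in each of at most $r$ rounds, one player (determined by the transcript so far) broadcasts a bit string that depends on that player's input and on the transcript; its output $\Pi(\mathbf Y)\in\{0,1\}$ is determined by the final transcript. Its cost $|\Pi|$ is the maximum, over joint inputs, of the total number of bits broadcast. **Structured rectangles.** A restriction is an element $\mathbf z$ of $\bigcup_{d\le m}\Omega^{\mathsf e,d}$; let $\Omega_{\mathbf z}\subseteq\Omega^{\mathsf e,m}$ be the set of all $\mathbf y$ that agree with $\mathbf z$ on $\mathrm{supp}(\mathbf z)$. A restriction $\mathbf z'$ subsumes $\mathbf z$ if $\mathrm{supp}(\mathbf z)\subseteq\mathrm{supp}(\mathbf z')$ and $\mathbf z'=\mathbf z$ on $\mathrm{supp}(\mathbf z)$. A set $A\subseteq\Omega_{\mathbf z}$ is $\mathbf z$-global if for every restriction $\mathbf z'$ that subsumes $\mathbf z$, $$\frac{|A\cap\Omega_{\mathbf z'}|}{|\Omega_{\mathbf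 z'}|}\le 2^{|\mathrm{supp}(\mathbf z')|-|\mathrm{supp}(\mathbf z)|}\,\frac{|A\cap \Omega_{\mathbf z}|}{|\Omega_{\mathbf z}|}.$$ A structured rectangle $(\boldsymbol\zeta,R)$ consists of restrictions $\boldsymbol\zeta=(\mathbf z^{(\mathsf e,j)})$ and a product $R=\prod_{(\mathsf e,j)} A^{(\mathsf e,j)}$ such that each $A^{(\mathsf e,j)}$ is $\mathbf z^{(\mathsf e,j)}$-global. Let $H_{\boldsymbol\zeta}$ be the hypergraph on $\mathcal V\times[n]$ with edge set $\bigcup_{(\mathsf e,j)}\mathrm{supp}(\mathbf z^{(\mathsf e,j)})$, and let $\|\boldsymbol\zeta\|=\sum_C|C|^2$, where $C$ runs over the connected components of $H_{\boldsymbol\zeta}$ with at least two vertices. Call $\boldsymbol\zeta$ cyclic if the sets $\mathrm{supp}(\mathbf z^{(\mathsf e,j)})$ are not pairwise disjoint, or if for some $\ell\ge1$ there are $\ell$ distinct edges of $H_{\boldsymbol\zeta}$ that cover at most $\ell(k-1)$ vertices. For real numbers $W_1,W_2\ge 0$, $(\boldsymbol\zeta,R)$ is $(W_1,W_2)$-good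 if $\boldsymbol\zeta$ is not cyclic, $|A^{(\mathsf e,j)}|/|\Omega_{\mathbf z^{(\mathsf e,j)}}|\ge 2^{-W_1}$ for all $(\mathsf e,j)$, and $\|\boldsymbol\zeta\|\le W_2$. **Lemma.** Let $k\ge2$, and fix a distribution-labeled $k$-graph $G$, an integer $K>0$ and $\alpha\in(0,1)$. There are constants $\eta_1,\eta_2\in(0,1)$, depending only on $G$, $\alpha$ and $K$, such that for all $n,r\in\mathbb N$ and every $r$-round protocol $\Pi$ for $\mathsf{DIHP}(G,n,\alpha,K)$ with $|\Pi|\le\eta_1^r n$ there is a collection $\mathcal R$ of structured rectangles $(\boldsymbol\zeta,R)$ with pairwise disjoint $R$ such that: 1. $\mathcal D_{\mathrm{no}}\bigl(\bigcup_{(\boldsymbol\zeta,R)\in\mathcal R}R\bigr)\ge 0.99$; 2. each $(\boldsymbol\zeta,R)\in\mathcal R$ is $(\eta_2^{-r}|\Pi|,\eta_2^{-r}|\Pi|)$-good; 3. for each $(\boldsymbol\zeta,R)\in\mathcal R$ there is $a_R\in\{0,1\}$ with $\Pi(\mathbf Y)=a_R$ for all $\mathbf Y\in R$. -/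

import Mathlib

open scoped ENNReal

namespace DIHP

/-! ### Hypergraphs whose edges are `k`-tuples of vertices -/

section Hypergraph

variable {k : ℕ} {Λ : Type*}

/-- A set of hyperedges is a matching if distinct edges have no common vertex. -/
def IsMatching (M : Set (Fin k → Λ)) : Prop :=
  M.PairwiseDisjoint fun e => Set.range e

/-- A set of hyperedges contains a cycle if, for some `ℓ ≥ 1`, there are `ℓ` distinct hyperedges
in it that cover at most `ℓ (k - 1)` vertices. -/
def HasCycle (S : Set (Fin k → Λ)) : Prop :=
  ∃ F : Finset (Fin k → Λ), F.Nonempty ∧ (F : Set (Fin k → Λ)) ⊆ S ∧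
    (⋃ e ∈ F, Set.range e).ncard ≤ F.card * (k - 1)

/-- The graph joining two distinct vertices that lie in a common hyperedge. Its connected
components are the connected components of the hypergraph. -/
def twoSection (S : Set (Fin k → Λ)) : SimpleGraph Λ :=
  SimpleGraph.fromRel fun u v => ∃ e ∈ S, u ∈ Set.range e ∧ v ∈ Set.range e

/-- The sum of `|C| ^ 2` over the connected components `C` with at least two vertices. -/
noncomputable def componentWeight (S : Set (Fin k → Λ)) : ℕ :=
  ∑ᶠ C ∈ {C : (twoSection S).ConnectedComponent | C.supp.Nontrivial}, C.supp.ncard ^ 2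

end Hypergraph

/-! ### Labeled matchings -/

section LabeledMatching

variable {k N : ℕ} {Λ : Type*}

/-- Maps from `k`-tuples to `ℤ_N ^ k ∪ {nil}`, with `none` in the role of `nil`. A map that is
defined only on the tuples of a `k`-universe is extended to all tuples by `nil`. -/
abbrev Labeling (k N : ℕ) (Λ : Type*) : Type _ :=
  (Fin k → Λ) → Option (Fin k → ZMod N)

/-- The support: the tuples that are not mapped to `nil`. -/
def supp (y : Labeling k N Λ) : Set (Fin k → Λ) :=
  {e | y e ≠ none}

/-- The space of labeled matchings with exactly `m` edges in the complete `k`-partite hypergraph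
with parts `U 0, …, U (k - 1)`. -/
def Omega (N : ℕ) (U : Fin k → Set Λ) (m : ℕ) : Set (Labeling k N Λ) :=
  {y | supp y ⊆ Set.univ.pi U ∧ IsMatching (supp y) ∧ (supp y).Finite ∧ (supp y).ncard = m}

/-- Restrictions: labeled matchings with at most `m` edges. -/
def Restrictions (N : ℕ) (U : Fin k → Set Λ) (m : ℕ) : Set (Labeling k N Λ) :=
  {z | ∃ d ≤ m, z ∈ Omega N U d}

/-- `z'` subsumes `z`. -/
def Subsumes (z' z : Labeling k N Λ) : Prop :=
  supp z ⊆ supp z' ∧ ∀ e ∈ supp z, z e = z' e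

/-- The restricted domain: the labeled matchings in `Omega N U m` that agree with `z` on the
support of `z`. -/
def OmegaRestrict (U : Fin k → Set Λ) (m : ℕ) (z : Labeling k N Λ) : Set (Labeling k N Λ) :=
  {y | y ∈ Omega N U m ∧ ∀ e ∈ supp z, y e = z e}

/-- The density of `A` inside the restricted domain given by `z`. -/
noncomputable def density (U : Fin k → Set Λ) (m : ℕ) (z : Labeling k N Λ)
    (A : Set (Labeling k N Λ)) : ℝ :=
  ((A ∩ OmegaRestrict U m z).ncard : ℝ) / ((OmegaRestrict U m z).ncard : ℝ)

/-- `A` is `z`-global: `A` lies in the restricted domain of `z`, and no restriction `z'` that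
subsumes `z` raises the density by more than the factor `2 ^ (|supp z'| - |supp z|)`. -/
def IsGlobal (U : Fin k → Set Λ) (m : ℕ) (z : Labeling k N Λ)
    (A : Set (Labeling k N Λ)) : Prop :=
  A ⊆ OmegaRestrict U m z ∧
    ∀ z' ∈ Restrictions N U m, Subsumes z' z →
      density U m z' A ≤
        (2 : ℝ) ^ ((supp z').ncard - (supp z).ncard) * density U m z A

end LabeledMatching

/-! ### Distribution-labeled `k`-graphs and the inputs of the game -/

/-- A distribution-labeled `k`-graph: a multiset of hyperedges (indexed by `E`), each an ordered
`k`-tuple of distinct vertices, a positive integer `N`, and for each hyperedge a one-wise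
independent probability distribution on `ℤ_N ^ k`. -/
structure DistLabeledGraph (k : ℕ) (V E : Type*) where
  edge : E → Fin k → V
  edge_injective : ∀ e, Function.Injective (edge e)
  N : ℕ
  N_pos : 0 < N
  μ : E → PMF (Fin k → ZMod N)
  oneWise : ∀ e i (a : ZMod N), ((μ e).map fun x => x i) a = (N : ℝ≥0∞)⁻¹

section Game

variable {k : ℕ} {V E : Type*} (G : DistLabeledGraph k V E) (n K : ℕ) (α : ℝ)

/-- The `k`-universe of the hyperedge `e` in the `n`-blow-up `V × [n]`: its `i`-th part consists of
the `n` copies of the `i`-th vertex of `e`. -/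
def DistLabeledGraph.parts (e : E) : Fin k → Set (V × Fin n) :=
  fun i => {u | u.1 = G.edge e i}

/-- Inputs of a player who is attached to the hyperedge `e`: labeled matchings with `⌊α n⌋` edges
in the blow-up of `e`. -/
abbrev DistLabeledGraph.Input (e : E) : Type _ :=
  ↥(Omega G.N (G.parts n e) ⌊α * n⌋₊)

/-- Joint inputs of the players `(e, j)`, where `e` is a hyperedge and `j ∈ [K]`. -/
abbrev DistLabeledGraph.JointInput : Type _ :=
  (p : E × Fin K) → G.Input n α p.1

instance [Finite V] (e : E) : Finite (G.Input n α e) := by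
  have : NeZero G.N := ⟨G.N_pos.ne'⟩
  have : Finite (ZMod G.N) := inferInstance
  have : Finite (Labeling k G.N (V × Fin n)) := inferInstance
  infer_instance

/-- The probability of an event under the no distribution, which is the uniform distribution on
the joint inputs. -/
noncomputable def DistLabeledGraph.probNo (S : Set (G.JointInput n K α)) : ℝ :=
  (S.ncard : ℝ) / (Nat.card (G.JointInput n K α) : ℝ)

/-- A structured rectangle: restrictions `z (e, j)` together with a rectangle
`∏ A (e, j)` such that each `A (e, j)` is `z (e, j)`-global. -/
structure StructuredRectangle where
  z : E × Fin K → Labeling k G.N (V × Fin n)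
  A : E × Fin K → Set (Labeling k G.N (V × Fin n))
  z_mem : ∀ p, z p ∈ Restrictions G.N (G.parts n p.1) ⌊α * n⌋₊
  isGlobal : ∀ p, IsGlobal (G.parts n p.1) ⌊α * n⌋₊ (z p) (A p)

namespace StructuredRectangle

variable {G n K α} (R : StructuredRectangle G n K α)

/-- The rectangle `∏ A (e, j)` as a set of joint inputs. -/
def rect : Set (G.JointInput n K α) :=
  {Y | ∀ p, (Y p : Labeling k G.N (V × Fin n)) ∈ R.A p}

/-- The edge set of the hypergraph on `V × [n]` formed by all supports. -/
def edges : Set (Fin k → V × Fin n) :=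
  ⋃ p, supp (R.z p)

/-- The weight of the restriction sequence. -/
noncomputable def weight : ℕ :=
  componentWeight R.edges

/-- The restriction sequence is cyclic. -/
def IsCyclic : Prop :=
  (¬ Pairwise fun p q => Disjoint (supp (R.z p)) (supp (R.z q))) ∨ HasCycle R.edges

/-- The structured rectangle is `(W₁, W₂)`-good. -/
def IsGood (W₁ W₂ : ℝ) : Prop :=
  ¬ R.IsCyclic ∧
    (∀ p, (2 : ℝ) ^ (-W₁) ≤
      ((R.A p).ncard : ℝ) / ((OmegaRestrict (G.parts n p.1) ⌊α * n⌋₊ (R.z p)).ncard : ℝ)) ∧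
    (R.weight : ℝ) ≤ W₂

end StructuredRectangle

end Game

/-! ### Deterministic communication protocols on a common blackboard -/

/-- A deterministic protocol for players `i : ι` with inputs in `X i`, as a tree. At an inner node
(one round) a player determined by the transcript so far broadcasts a bit string, which is a
function of that player's own input, and the protocol continues according to the string. The
length of the string may depend on the input; rounds with a fixed message length are a special
case. At a leaf the output bit is fixed. -/
inductive Protocol {ι : Type*} (X : ι → Type*) : Type _ where
  | output (b : Bool) : Protocol X
  | speak (i : ι) (msg : X i → List Bool) (next : List Bool → Protocol X) : Protocol X

namespace Protocol

variable {ι : Type*} {X : ι → Type*}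

/-- The output of the protocol on a joint input. -/
def eval : Protocol X → ((i : ι) → X i) → Bool
  | output b, _ => b
  | speak i msg next, Y => (next (msg (Y i))).eval Y

/-- The number of bits broadcast by all players on a joint input. -/
def bits : Protocol X → ((i : ι) → X i) → ℕ
  | output _, _ => 0
  | speak i msg next, Y => (msg (Y i)).length + (next (msg (Y i))).bits Y

/-- The number of rounds on a joint input. -/
def rounds : Protocol X → ((i : ι) → X i) → ℕ
  | output _, _ => 0
  | speak i msg next, Y => 1 + (next (msg (Y i))).rounds Y

/-- The protocol uses at most `r` rounds on every joint input. -/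
def IsRound (P : Protocol X) (r : ℕ) : Prop :=
  ∀ Y, P.rounds Y ≤ r

/-- The communication cost: the largest number of bits broadcast on any joint input. -/
noncomputable def cost (P : Protocol X) : ℕ :=
  ⨆ Y, P.bits Y

theorem bits_le_cost [Finite ((i : ι) → X i)] (P : Protocol X) (Y : (i : ι) → X i) :
    P.bits Y ≤ P.cost :=
  le_ciSup (Set.finite_range P.bits).bddAbove Y

end Protocol

end DIHP

/-!
The structured rectangles are found by following the protocol from its root and refining one
rectangle in every round.

When a player speaks, the fibres of the message in that player's set are cut into global pieces:
among all restrictions one takes the one with the largest density, discounted by a factor of `2` for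
each hyperedge, splits off the corresponding piece, and continues with the rest until it is
negligible (`exists_global_decomposition`). Every piece has density at least `2 ^ (-D)` with a `D`
that grows only by the length of the message and a term for the permitted loss. Since a density is
at most one, the same `D` bounds the number of newly prescribed hyperedges.

The main point is that the new hyperedges are part of the input of one player, which is nearly
independent of the hypergraph `H` of all hyperedges prescribed so far: in a global set, prescribed
hyperedges occur with about the same probability as in a uniformly random matching
(`IsGlobal.ncard_through_mul_le`). The hyperedges of such an input merge components of `H` along
trails that alternate between components of `H` and distinct hyperedges of the input
(`exists_trail`). If `w` is the number of linked pairs of `H`, that is, the sum of the squared sizes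
of its components, then the expected number of trails with `L` hyperedges is at most `w ρ ^ L` with
`ρ = O(w / n)`. Summing the geometric series, the expected number of linked pairs after the round
is `O(w)` plus the contribution of the new hyperedges (`IsGlobal.sum_mergedPairs_le`), and a cycle,
which requires a closed trail (`not_hasCycle_union`), arises with probability `O(w / n)`
(`IsGlobal.ncard_hasClosedTrail_le`). Both estimates hold for all hyperedges of the input at once
and therefore do not depend on how the pieces were chosen.

Over `r` rounds the expectation of `w` grows by a factor of `C ^ r`, while the loss stays small
because the cost is at most `η₁ ^ r n` (`exists_decomposition`). It is essential to control the
expectation of `w` throughout and to apply Markov's inequality only once, at the end: an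
application in every round would cost a factor of order `r ^ r`.
-/

namespace DIHP

/-! ### Components and acyclicity of hypergraphs -/

section Hypergraph

variable {k : ℕ} {Λ : Type*}

/-- The set of vertices that lie in some hyperedge of `S`. -/
def cover (S : Set (Fin k → Λ)) : Set Λ :=
  ⋃ e ∈ S, Set.range e

theorem mem_cover {S : Set (Fin k → Λ)} {u : Λ} : u ∈ cover S ↔ ∃ e ∈ S, u ∈ Set.range e := by
  simp [cover]

theorem cover_union (S T : Set (Fin k → Λ)) : cover (S ∪ T) = cover S ∪ cover T := by
  ext u; simp only [mem_cover, Set.mem_union]; grind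

theorem cover_mono {S T : Set (Fin k → Λ)} (h : S ⊆ T) : cover S ⊆ cover T := by
  intro u; simp only [mem_cover]; grind

theorem twoSection_adj {S : Set (Fin k → Λ)} {u v : Λ} :
    (twoSection S).Adj u v ↔ u ≠ v ∧ ∃ e ∈ S, u ∈ Set.range e ∧ v ∈ Set.range e := by
  simp only [twoSection, SimpleGraph.fromRel_adj]; grind

/-- Two vertices are linked by `S` if they lie in the same connected component. -/
def Linked (S : Set (Fin k → Λ)) (u v : Λ) : Prop :=
  (twoSection S).Reachable u v

namespace Linked

variable {S T : Set (Fin k → Λ)} {u v w : Λ}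

theorem refl (S : Set (Fin k → Λ)) (u : Λ) : Linked S u u :=
  SimpleGraph.Reachable.refl u

theorem symm (h : Linked S u v) : Linked S v u :=
  SimpleGraph.Reachable.symm h

theorem trans (h : Linked S u v) (h' : Linked S v w) : Linked S u w :=
  SimpleGraph.Reachable.trans h h'

theorem of_mem {e : Fin k → Λ} (he : e ∈ S) (hu : u ∈ Set.range e) (hv : v ∈ Set.range e) :
    Linked S u v := by
  by_cases h : u = v
  · exact h ▸ refl S u
  · exact (twoSection_adj.2 ⟨h, e, he, hu, hv⟩).reachable

/-- Induction along a path towards the fixed endpoint `v`. -/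
theorem head_induction {P : Λ → Prop} (h : Linked S u v) (base : P v)
    (step : ∀ x y, ∀ e ∈ S, x ∈ Set.range e → y ∈ Set.range e → x ≠ y → P y → P x) : P u := by
  have h' := (SimpleGraph.reachable_iff_reflTransGen u v).1 h
  induction h' using Relation.ReflTransGen.head_induction_on with
  | refl => exact base
  | head hab hbc ih =>
    obtain ⟨hne, e, he, ha, hb⟩ := twoSection_adj.1 hab
    exact step _ _ e he ha hb hne (ih ((SimpleGraph.reachable_iff_reflTransGen _ _).2 hbc))

theorem mono (hST : S ⊆ T) (h : Linked S u v) : Linked T u v :=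
  head_induction (P := fun x => Linked T x v) h (refl T v)
    fun _ _ _ he hx hy _ ih => (of_mem (hST he) hx hy).trans ih

theorem eq_of_notMem_cover (hv : v ∉ cover S) (h : Linked S u v) : u = v :=
  head_induction (P := fun x => x = v) h rfl fun _ _ e he _ hy _ ih =>
    absurd (mem_cover.2 ⟨e, he, ih ▸ hy⟩) hv

theorem mem_cover_of_mem (h : Linked S u v) (hv : v ∈ cover S) : u ∈ cover S := by
  by_contra hu
  exact hu (eq_of_notMem_cover hu h.symm ▸ hv)

end Linked

theorem not_hasCycle_iff {S : Set (Fin k → Λ)} :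
    ¬ HasCycle S ↔ ∀ F : Finset (Fin k → Λ), F.Nonempty → (F : Set (Fin k → Λ)) ⊆ S →
      F.card * (k - 1) < (cover (F : Set (Fin k → Λ))).ncard := by
  simp [HasCycle, cover]

/-- In an acyclic hypergraph the bound `|F| (k - 1)` on the number of covered vertices survives the
deletion of one vertex from each connected component. -/
theorem card_mul_le_ncard_cover_diff [Finite Λ] {T : Set (Fin k → Λ)} (hT : ¬ HasCycle T)
    (X : Finset Λ) : (∀ x ∈ X, ∀ y ∈ X, x ≠ y → ¬ Linked T x y) →
    ∀ Q : Finset (Fin k → Λ), (Q : Set (Fin k → Λ)) ⊆ T →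
      Q.card * (k - 1) ≤ (cover (Q : Set (Fin k → Λ)) \ X).ncard := by
  classical
  induction X using Finset.induction_on with
  | empty =>
    intro _ Q hQ
    rcases Q.eq_empty_or_nonempty with rfl | hne
    · simp
    · simpa using (not_hasCycle_iff.1 hT Q hne hQ).le
  | insert a X ha ih =>
    intro hX Q hQ
    let Q₁ := Q.filter fun e => ∃ x ∈ Set.range e, Linked T x a
    let Q₂ := Q.filter fun e => ¬ ∃ x ∈ Set.range e, Linked T x a
    have hcard : Q₁.card + Q₂.card = Q.card := Finset.card_filter_add_card_filter_not _
    have h₁T : (Q₁ : Set (Fin k → Λ)) ⊆ T := fun e he => hQ (Finset.mem_filter.1 he).1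
    have h₂T : (Q₂ : Set (Fin k → Λ)) ⊆ T := fun e he => hQ (Finset.mem_filter.1 he).1
    have hlink₁ : ∀ x ∈ cover (Q₁ : Set (Fin k → Λ)), Linked T x a := by
      intro x hx
      obtain ⟨e, he, hxe⟩ := mem_cover.1 hx
      obtain ⟨y, hy, hya⟩ := (Finset.mem_filter.1 he).2
      exact (Linked.of_mem (h₁T he) hxe hy).trans hya
    have hlink₂ : ∀ x ∈ cover (Q₂ : Set (Fin k → Λ)), ¬ Linked T x a := by
      intro x hx hxa
      obtain ⟨e, he, hxe⟩ := mem_cover.1 hx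
      exact (Finset.mem_filter.1 he).2 ⟨x, hxe, hxa⟩
    have hdisj : Disjoint (cover (Q₁ : Set (Fin k → Λ)) \ {a})
        (cover (Q₂ : Set (Fin k → Λ)) \ X) :=
      Set.disjoint_left.2 fun x hx hx' => hlink₂ x hx'.1 (hlink₁ x hx.1)
    have hsub : (cover (Q₁ : Set (Fin k → Λ)) \ {a}) ∪ (cover (Q₂ : Set (Fin k → Λ)) \ X) ⊆
        cover (Q : Set (Fin k → Λ)) \ ((insert a X : Finset Λ) : Set Λ) := by
      rintro x (⟨hx, hxa⟩ | ⟨hx, hxX⟩)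
      · refine ⟨cover_mono (fun e he => (Finset.mem_filter.1 he).1) hx, fun hmem => ?_⟩
        have hmem' : x ∈ insert a X := hmem
        exact hX x hmem' a (Finset.mem_insert_self a X) hxa (hlink₁ x hx)
      · refine ⟨cover_mono (fun e he => (Finset.mem_filter.1 he).1) hx, fun hmem => ?_⟩
        rcases Finset.mem_insert.1 hmem with rfl | h
        · exact hlink₂ x hx (Linked.refl T x)
        · exact hxX h
    have h₁ : Q₁.card * (k - 1) ≤ (cover (Q₁ : Set (Fin k → Λ)) \ {a}).ncard := by
      rcases Q₁.eq_empty_or_nonempty with h | hne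
      · simp [h]
      · have := not_hasCycle_iff.1 hT Q₁ hne h₁T
        have := Set.pred_ncard_le_ncard_sdiff_singleton (cover (Q₁ : Set (Fin k → Λ))) a
        omega
    have h₂ := ih (fun x hx y hy => hX x (Finset.mem_insert_of_mem hx) y
      (Finset.mem_insert_of_mem hy)) Q₂ h₂T
    calc Q.card * (k - 1) = Q₁.card * (k - 1) + Q₂.card * (k - 1) := by rw [← hcard, add_mul]
      _ ≤ _ := add_le_add h₁ h₂
      _ = _ := (Set.ncard_union_eq hdisj).symm
      _ ≤ _ := Set.ncard_le_ncard hsub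

/-- Adding a hyperedge whose vertices lie in different components creates no cycle. -/
theorem not_hasCycle_insert [Finite Λ] (hk : 2 ≤ k) {T : Set (Fin k → Λ)} (hT : ¬ HasCycle T)
    {e : Fin k → Λ} (he : Function.Injective e)
    (h : ∀ x ∈ Set.range e, ∀ y ∈ Set.range e, x ≠ y → ¬ Linked T x y) :
    ¬ HasCycle (insert e T) := by
  classical
  rw [not_hasCycle_iff]
  intro Q hne hQ
  by_cases heQ : e ∈ Q
  · have hQ' : ((Q.erase e : Finset _) : Set (Fin k → Λ)) ⊆ T := by
      intro f hf
      obtain ⟨hfe, hfQ⟩ := Finset.mem_erase.1 hf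
      exact (hQ hfQ).resolve_left hfe
    have key := card_mul_le_ncard_cover_diff hT (Finset.univ.image e)
      (by simpa using h) (Q.erase e) hQ'
    have hsub : Set.range e ∪ (cover ((Q.erase e : Finset _) : Set (Fin k → Λ)) \
        ((Finset.univ.image e : Finset Λ) : Set Λ)) ⊆ cover (Q : Set (Fin k → Λ)) := by
      rintro x (hx | hx)
      · exact mem_cover.2 ⟨e, heQ, hx⟩
      · exact cover_mono (fun f hf => Finset.mem_of_mem_erase hf) hx.1
    have hle := Set.ncard_le_ncard hsub
    rw [Set.ncard_union_eq (by
      refine Set.disjoint_left.2 fun x hx hx' => hx'.2 ?_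
      simpa using hx)] at hle
    have hrange : (Set.range e).ncard = k := by
      rw [← Set.image_univ, Set.ncard_image_of_injective _ he]; simp
    have hc : Q.card = (Q.erase e).card + 1 := (Finset.card_erase_add_one heQ).symm
    rw [hc, add_mul]
    omega
  · exact not_hasCycle_iff.1 hT Q hne fun f hf =>
      (hQ hf).resolve_left fun h' => heQ (h' ▸ hf)

/-- The ordered pairs of linked vertices that are covered by `S`. Their number is the sum of
`|C| ^ 2` over the components `C` of `S` that contain an edge. -/
def linkedPairs (S : Set (Fin k → Λ)) : Set (Λ × Λ) :=
  {p | p.1 ∈ cover S ∧ Linked S p.1 p.2}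

theorem componentWeight_le [Finite Λ] (S : Set (Fin k → Λ)) :
    componentWeight S ≤ (linkedPairs S).ncard := by
  classical
  have : Fintype (twoSection S).ConnectedComponent := Fintype.ofFinite _
  unfold componentWeight
  rw [finsum_mem_eq_finite_toFinset_sum _ (Set.toFinite _)]
  have hrw : ∀ C : (twoSection S).ConnectedComponent,
      C.supp.ncard ^ 2 = (C.supp ×ˢ C.supp).toFinite.toFinset.card := by
    intro C
    rw [← Set.ncard_eq_toFinset_card, Set.ncard_prod, sq]
  simp only [hrw]
  rw [← Finset.card_biUnion, ← Set.ncard_coe_finset]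
  · refine Set.ncard_le_ncard ?_
    rintro ⟨u, v⟩ huv
    simp only [Finset.coe_biUnion, Set.mem_iUnion, Finset.mem_coe, Set.Finite.mem_toFinset] at huv
    obtain ⟨C, hC, hu, hv⟩ := huv
    have hlink : ∀ a ∈ C.supp, ∀ b ∈ C.supp, Linked S a b := by
      intro a ha b hb
      exact SimpleGraph.ConnectedComponent.exact
        ((SimpleGraph.ConnectedComponent.mem_supp_iff _ _).1 ha |>.trans
          ((SimpleGraph.ConnectedComponent.mem_supp_iff _ _).1 hb).symm)
    refine ⟨?_, hlink u hu v hv⟩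
    obtain ⟨w, hw, hne⟩ := Set.Nontrivial.exists_ne hC u
    by_contra hcov
    exact hne (Linked.eq_of_notMem_cover hcov (hlink w hw u hu))
  · intro C _ D _ hCD
    refine Finset.disjoint_left.2 ?_
    rintro ⟨u, v⟩ h h'
    simp only [Set.Finite.mem_toFinset, Set.mem_prod] at h h'
    exact hCD (((SimpleGraph.ConnectedComponent.mem_supp_iff _ _).1 h.1).symm.trans
      ((SimpleGraph.ConnectedComponent.mem_supp_iff _ _).1 h'.1))

end Hypergraph

/-! ### Adding a matching to a hypergraph -/

section Trails

variable {k : ℕ} {Λ : Type*}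

/-- `Trail H l u v`: one gets from `u` to `v` by crossing the hyperedges in the list `l` one after
the other, moving inside components of `H` in between. Every crossing joins two distinct vertices
and ends in a vertex that is covered by `H`. -/
inductive Trail (H : Set (Fin k → Λ)) : List (Fin k → Λ) → Λ → Λ → Prop
  | nil {u v : Λ} (h : Linked H u v) : Trail H [] u v
  | cons {e : Fin k → Λ} {l : List (Fin k → Λ)} {u x y v : Λ} (h : Linked H u x)
      (hx : x ∈ Set.range e) (hy : y ∈ Set.range e) (hne : x ≠ y) (hyH : y ∈ cover H)
      (ht : Trail H l y v) : Trail H (e :: l) u v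

variable {H F : Set (Fin k → Λ)}

theorem Trail.of_linked {l : List (Fin k → Λ)} {u u' v : Λ} (h : Linked H u u')
    (ht : Trail H l u' v) : Trail H l u v := by
  cases ht with
  | nil h' => exact .nil (h.trans h')
  | cons h' hx hy hne hyH ht => exact .cons (h.trans h') hx hy hne hyH ht

/-- A trail through `e` can be cut short after its crossing of `e`. -/
theorem Trail.exists_suffix {l : List (Fin k → Λ)} {u v : Λ} (ht : Trail H l u v)
    {e : Fin k → Λ} (he : e ∈ l) :
    ∃ l' y, (e :: l').Sublist l ∧ y ∈ Set.range e ∧ y ∈ cover H ∧ Trail H l' y v := by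
  induction ht with
  | nil h => simp at he
  | @cons f l u x y v h hx hy hne hyH ht ih =>
    rcases List.mem_cons.1 he with rfl | he
    · exact ⟨l, y, List.Sublist.refl _, hy, hyH, ht⟩
    · obtain ⟨l', y', hl', h'⟩ := ih he
      exact ⟨l', y', hl'.trans (List.sublist_cons_self _ _), h'⟩

/-- Linking vertices through `H` and a matching `F` is possible along a trail without repetitions:
a second crossing of the same hyperedge is a detour. -/
theorem exists_trail (hF : ∀ e ∈ F, ∀ f ∈ F, ∀ x, x ∈ Set.range e → x ∈ Set.range f → e = f)
    {u v : Λ} (hv : v ∈ cover H) (h : Linked (H ∪ F) u v) :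
    ∃ l : List (Fin k → Λ), l.Nodup ∧ (∀ e ∈ l, e ∈ F) ∧ Trail H l u v := by
  refine Linked.head_induction (P := fun u => ∃ l : List (Fin k → Λ), l.Nodup ∧ (∀ e ∈ l, e ∈ F) ∧
    Trail H l u v) h ⟨[], List.nodup_nil, by simp, .nil (.refl _ _)⟩ ?_
  rintro x y e (he | he) hx hy hne ⟨l, hl, hlF, ht⟩
  · exact ⟨l, hl, hlF, ht.of_linked (.of_mem he hx hy)⟩
  · by_cases hel : e ∈ l
    · obtain ⟨l', y', hl', hy', hyH, ht'⟩ := ht.exists_suffix hel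
      have hnd := hl.sublist hl'
      by_cases hxy : x = y'
      · exact ⟨l', (List.nodup_cons.1 hnd).2,
          fun f hf => hlF f (hl'.subset (List.mem_cons_of_mem _ hf)), hxy ▸ ht'⟩
      · exact ⟨e :: l', hnd, fun f hf => hlF f (hl'.subset hf),
          .cons (.refl _ _) hx hy' hxy hyH ht'⟩
    · have hyH : y ∈ cover H := by
        by_contra hyH
        cases ht with
        | nil h' => exact hyH (h'.mem_cover_of_mem hv)
        | @cons f l u x' y' v h' hx' hy' hne' hyH' ht' =>
          have hyx : x' = y := Linked.eq_of_notMem_cover hyH h'.symm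
          have : e = f := hF e he f (hlF f List.mem_cons_self) y hy (hyx ▸ hx')
          exact hel (this ▸ List.mem_cons_self)
      exact ⟨e :: l, List.nodup_cons.2 ⟨hel, hl⟩, by simpa using ⟨he, hlF⟩,
        .cons (.refl _ _) hx hy hne hyH ht⟩

/-- A closed trail: a trail of distinct hyperedges in `F` that starts and ends in the same
vertex `x` covered by `H`, and crosses at least one hyperedge. -/
def HasClosedTrail (H F : Set (Fin k → Λ)) : Prop :=
  ∃ (e : Fin k → Λ) (l : List (Fin k → Λ)) (x y : Λ), x ≠ y ∧ x ∈ Set.range e ∧ y ∈ Set.range e ∧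
    x ∈ cover H ∧ y ∈ cover H ∧ (e :: l).Nodup ∧ (∀ f ∈ e :: l, f ∈ F) ∧ Trail H l y x

/-- If there is no closed trail, then the hyperedges of the matching `F` are no hyperedges
of `H`. -/
theorem disjoint_of_not_hasClosedTrail (hk : 2 ≤ k) (hinj : ∀ e ∈ F, Function.Injective e)
    (h : ¬ HasClosedTrail H F) : Disjoint F H := by
  refine Set.disjoint_left.2 fun e he heH => h ?_
  have hne : e ⟨0, by omega⟩ ≠ e ⟨1, by omega⟩ := fun h' => by simpa using hinj e he h'
  have hx : e ⟨0, by omega⟩ ∈ Set.range e := Set.mem_range_self _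
  have hy : e ⟨1, by omega⟩ ∈ Set.range e := Set.mem_range_self _
  exact ⟨e, [], _, _, hne, hx, hy, mem_cover.2 ⟨e, heH, hx⟩, mem_cover.2 ⟨e, heH, hy⟩, by simp,
    by simpa using he, .nil (.of_mem heH hy hx)⟩

/-- If there is no closed trail, then adding part of the matching `F` to `H` creates no cycle. -/
theorem not_hasCycle_union [Finite Λ] (hk : 2 ≤ k) (hH : ¬ HasCycle H)
    (hinj : ∀ e ∈ F, Function.Injective e)
    (hF : ∀ e ∈ F, ∀ f ∈ F, ∀ x, x ∈ Set.range e → x ∈ Set.range f → e = f)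
    (h : ¬ HasClosedTrail H F) {S : Set (Fin k → Λ)} (hS : S ⊆ F) : ¬ HasCycle (H ∪ S) := by
  induction S, S.toFinite using Set.Finite.induction_on with
  | empty => simpa using hH
  | @insert e S he _ ih =>
    have heF : e ∈ F := hS (Set.mem_insert e S)
    have hSF : S ⊆ F := (Set.subset_insert e S).trans hS
    rw [Set.union_insert]
    refine not_hasCycle_insert hk (ih hSF) (hinj e heF) fun x hx y hy hne hlink => h ?_
    -- a vertex of `e` outside the cover of `H` is isolated, since `F` is a matching.
    have hcov : ∀ x ∈ Set.range e, ∀ y, x ≠ y → Linked (H ∪ S) y x → x ∈ cover H := by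
      intro x hx y hne hlink
      by_contra hxH
      refine hne (Linked.eq_of_notMem_cover ?_ hlink).symm
      rw [cover_union]
      rintro (h' | h')
      · exact hxH h'
      · obtain ⟨f, hf, hxf⟩ := mem_cover.1 h'
        exact he (hF e heF f (hSF hf) x hx hxf ▸ hf)
    have hxH := hcov x hx y hne hlink.symm
    have hyH := hcov y hy x hne.symm hlink
    obtain ⟨l, hl, hlS, ht⟩ := exists_trail
      (fun e he f hf => hF e (hSF he) f (hSF hf)) hxH hlink.symm
    exact ⟨e, l, x, y, hne, hx, hy, hxH, hyH, List.nodup_cons.2 ⟨fun h' => he (hlS e h'), hl⟩,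
      by simpa using ⟨heF, fun f hf => hSF (hlS f hf)⟩, ht⟩

/-- The pairs of vertices covered by `H` that are linked by `H` together with `F`. -/
def mergedPairs (H F : Set (Fin k → Λ)) : Set (Λ × Λ) :=
  {p | p.1 ∈ cover H ∧ p.2 ∈ cover H ∧ Linked (H ∪ F) p.1 p.2}

/-- Adding a part `S` of a matching `F` to `H` gives few linked pairs: in a component that meets the
cover of `H`, every vertex is covered by `H` or shares a hyperedge of `S` with a vertex covered
by `H`, and the remaining components are single hyperedges of `S`. -/
theorem ncard_linkedPairs_union_le [Finite Λ]
    (hF : ∀ e ∈ F, ∀ f ∈ F, ∀ x, x ∈ Set.range e → x ∈ Set.range f → e = f)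
    {S : Set (Fin k → Λ)} (hS : S ⊆ F) :
    (linkedPairs (H ∪ S)).ncard ≤ (k + 1) ^ 2 * (mergedPairs H F).ncard + k ^ 2 * S.ncard := by
  classical
  -- `φ w` enumerates `w` and the vertices of the hyperedge of `F` that contains `w`, if any.
  let φ : Λ → Option (Fin k) → Λ := fun w o => o.elim w fun i =>
    if h : ∃ e ∈ F, w ∈ Set.range e then h.choose i else w
  have hφ : ∀ e ∈ F, ∀ w ∈ Set.range e, ∀ i, φ w (some i) = e i := by
    intro e he w hw i
    have h : ∃ e ∈ F, w ∈ Set.range e := ⟨e, he, hw⟩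
    have := hF h.choose h.choose_spec.1 e he w h.choose_spec.2 hw
    simp only [φ, Option.elim, dif_pos h, this]
  have hcases : ∀ u ∈ cover (H ∪ S), (∃ w ∈ cover H, ∃ o, u = φ w o ∧ Linked (H ∪ S) u w) ∨
      ∃ e ∈ S, u ∈ Set.range e ∧ ∀ w ∈ Set.range e, w ∉ cover H := by
    intro u hu
    by_cases huH : u ∈ cover H
    · exact .inl ⟨u, huH, none, rfl, .refl _ _⟩
    · rw [cover_union] at hu
      obtain ⟨e, he, i, rfl⟩ := mem_cover.1 (hu.resolve_left huH)
      by_cases hmeet : ∃ w ∈ Set.range e, w ∈ cover H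
      · obtain ⟨w, hw, hwH⟩ := hmeet
        exact .inl ⟨w, hwH, some i, (hφ e (hS he) w hw i).symm,
          .of_mem (.inr he) (Set.mem_range_self i) hw⟩
      · push Not at hmeet
        exact .inr ⟨e, he, Set.mem_range_self i, hmeet⟩
  have hisol : ∀ e ∈ S, (∀ w ∈ Set.range e, w ∉ cover H) → ∀ u ∈ Set.range e, ∀ v,
      Linked (H ∪ S) v u → v ∈ Set.range e := by
    intro e he hw u hu v hlink
    refine Linked.head_induction (P := fun v => v ∈ Set.range e) hlink hu ?_
    rintro x y f (hf | hf) hx hy _ ih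
    · exact absurd (mem_cover.2 ⟨f, hf, hy⟩) (hw y ih)
    · exact hF e (hS he) f (hS hf) y ih hy ▸ hx
  let P := (mergedPairs H F).toFinite.toFinset
  let Q := S.toFinite.toFinset
  let I₁ := P.biUnion fun p =>
    (Finset.univ : Finset (Option (Fin k) × Option (Fin k))).image fun o => (φ p.1 o.1, φ p.2 o.2)
  let I₂ := Q.biUnion fun e =>
    (Finset.univ : Finset (Fin k × Fin k)).image fun o => (e o.1, e o.2)
  have hsub : linkedPairs (H ∪ S) ⊆ ((I₁ ∪ I₂ : Finset (Λ × Λ)) : Set (Λ × Λ)) := by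
    rintro ⟨u, v⟩ ⟨hu, hlink⟩
    have hmem₂ : ∀ e ∈ S, u ∈ Set.range e → v ∈ Set.range e → (u, v) ∈ I₁ ∪ I₂ := by
      rintro e he ⟨i, rfl⟩ ⟨j, rfl⟩
      refine Finset.mem_union_right _ (Finset.mem_biUnion.2 ⟨e, by simpa [Q] using he, ?_⟩)
      exact Finset.mem_image.2 ⟨(i, j), Finset.mem_univ _, rfl⟩
    have hv : v ∈ cover (H ∪ S) := hlink.symm.mem_cover_of_mem hu
    rcases hcases u hu with ⟨w, hw, o, hwo, huw⟩ | ⟨e, he, hue, hiso⟩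
    · rcases hcases v hv with ⟨w', hw', o', hwo', hvw⟩ | ⟨e, he, hve, hiso⟩
      · refine Finset.mem_union_left _ (Finset.mem_biUnion.2 ⟨(w, w'), ?_, ?_⟩)
        · have : Linked (H ∪ F) w w' :=
            ((huw.symm.trans hlink).trans hvw).mono (Set.union_subset_union_right H hS)
          simpa [P] using show (w, w') ∈ mergedPairs H F from ⟨hw, hw', this⟩
        · exact Finset.mem_image.2 ⟨(o, o'), Finset.mem_univ _, by simp [hwo, hwo']⟩
      · exact hmem₂ e he (hisol e he hiso v hve u hlink) hve
    · exact hmem₂ e he hue (hisol e he hiso u hue v hlink.symm)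
  have h₁ : I₁.card ≤ P.card * (k + 1) ^ 2 := Finset.card_biUnion_le_card_mul _ _ _ fun p _ =>
    Finset.card_image_le.trans (by simp [sq])
  have h₂ : I₂.card ≤ Q.card * k ^ 2 := Finset.card_biUnion_le_card_mul _ _ _ fun p _ =>
    Finset.card_image_le.trans (by simp [sq])
  have hP : P.card = (mergedPairs H F).ncard := (Set.ncard_eq_toFinset_card _ _).symm
  have hQ : Q.card = S.ncard := (Set.ncard_eq_toFinset_card _ _).symm
  calc (linkedPairs (H ∪ S)).ncard ≤ (I₁ ∪ I₂).card := by
        rw [← Set.ncard_coe_finset]; exact Set.ncard_le_ncard hsub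
    _ ≤ I₁.card + I₂.card := Finset.card_union_le _ _
    _ ≤ _ := by rw [← hP, ← hQ, mul_comm _ P.card, mul_comm _ Q.card]; exact add_le_add h₁ h₂

end Trails

/-! ### Counting hyperedges and trails -/

section Counting

variable {k N : ℕ} {Λ : Type*}

theorem isMatching_iff {M : Set (Fin k → Λ)} :
    IsMatching M ↔ ∀ e ∈ M, ∀ f ∈ M, ∀ x, x ∈ Set.range e → x ∈ Set.range f → e = f := by
  constructor
  · intro h e he f hf x hx hx'
    by_contra hne
    exact Set.disjoint_left.1 (h he hf hne) hx hx'
  · intro h e he f hf hne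
    exact Set.disjoint_left.2 fun x hx hx' => hne (h e he f hf x hx hx')

theorem mem_part_unique {U : Fin k → Set Λ} (hU : Pairwise fun i j => Disjoint (U i) (U j))
    {i j : Fin k} {x : Λ} (hi : x ∈ U i) (hj : x ∈ U j) : i = j := by
  by_contra h
  exact Set.disjoint_left.1 (hU h) hi hj

/-- The number of hyperedges through two given vertices in the `k`-partite universe. -/
theorem ncard_edges_through_le [Finite Λ] {n : ℕ} {U : Fin k → Set Λ}
    (hn : ∀ i, (U i).ncard = n) {x y : Λ} (hxy : x ≠ y) :
    {e ∈ Set.univ.pi U | x ∈ Set.range e ∧ y ∈ Set.range e}.ncard ≤ k ^ 2 * n ^ (k - 2) := by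
  classical
  have : Fintype Λ := Fintype.ofFinite Λ
  let I : Finset (Fin k × Fin k) := Finset.univ.filter fun p => p.1 ≠ p.2
  let c : Fin k × Fin k → Fin k → Finset Λ := fun p l =>
    if l = p.1 then {x} else if l = p.2 then {y} else (U l).toFinset
  have hsub : {e ∈ Set.univ.pi U | x ∈ Set.range e ∧ y ∈ Set.range e} ⊆
      ((I.biUnion fun p => Fintype.piFinset (c p) : Finset (Fin k → Λ)) : Set (Fin k → Λ)) := by
    rintro e ⟨he, ⟨i, hi⟩, ⟨j, hj⟩⟩
    refine Finset.mem_coe.2 (Finset.mem_biUnion.2 ⟨(i, j), ?_, Fintype.mem_piFinset.2 fun l => ?_⟩)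
    · simp only [I, Finset.mem_filter, Finset.mem_univ, true_and]
      rintro rfl
      exact hxy (hi.symm.trans hj)
    · simp only [c]
      split_ifs with h h'
      · simp [h, hi]
      · simp [h', hj]
      · simpa using he l (Set.mem_univ l)
  have hcard : ∀ p ∈ I, (Fintype.piFinset (c p)).card ≤ n ^ (k - 2) := by
    rintro ⟨i, j⟩ hp
    have hij : i ≠ j := by simpa [I] using hp
    have hc : ∀ l, (c (i, j) l).card = if l ∈ ({i, j} : Finset (Fin k)) then 1 else n := by
      intro l
      by_cases h : l = i
      · simp [c, h]
      · by_cases h' : l = j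
        · simp [c, h']; split_ifs <;> simp
        · simp [c, h, h', ← hn l, Set.ncard_eq_toFinset_card']
    rw [Fintype.card_piFinset, Finset.prod_congr rfl fun l _ => hc l, Finset.prod_ite]
    simp only [Finset.prod_const_one, one_mul, Finset.prod_const]
    have : (Finset.univ.filter fun l => l ∉ ({i, j} : Finset (Fin k))) = ({i, j} : Finset _)ᶜ := by
      ext; simp
    rw [this, Finset.card_compl, Finset.card_pair hij, Fintype.card_fin]
  calc _ ≤ (I.biUnion fun p => Fintype.piFinset (c p)).card := by
        rw [← Set.ncard_coe_finset]; exact Set.ncard_le_ncard hsub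
    _ ≤ I.card * n ^ (k - 2) := Finset.card_biUnion_le_card_mul _ _ _ hcard
    _ ≤ k ^ 2 * n ^ (k - 2) := by
        gcongr
        exact (Finset.card_le_univ _).trans (by simp [sq])

/-- The number of trails with `L` hyperedges of the `k`-partite universe and with endpoints covered
by `H` is at most `w (k ^ 2 n ^ (k - 2) w) ^ L`, where `w` is the number of linked pairs. A trail
consists of a linked pair, a hyperedge through its second vertex, and a shorter trail. -/
theorem exists_finset_trail [Finite Λ] {n : ℕ} {U : Fin k → Set Λ}
    (hn : ∀ i, (U i).ncard = n) (H : Set (Fin k → Λ)) (L : ℕ) :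
    ∃ T : Finset (List (Fin k → Λ) × Λ × Λ),
      (∀ l u v, l.length = L → (∀ e ∈ l, e ∈ Set.univ.pi U) → u ∈ cover H → v ∈ cover H →
        Trail H l u v → (l, u, v) ∈ T) ∧
      (∀ t ∈ T, t.1.length = L) ∧
      T.card ≤ (linkedPairs H).ncard * ((linkedPairs H).ncard * (k ^ 2 * n ^ (k - 2))) ^ L := by
  classical
  induction L with
  | zero =>
    refine ⟨(linkedPairs H).toFinite.toFinset.image fun p => ([], p), ?_, ?_, ?_⟩
    · intro l u v hl _ hu hv ht
      obtain rfl := List.length_eq_zero_iff.1 hl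
      cases ht with
      | nil h =>
        exact Finset.mem_image.2 ⟨(u, v), (Set.Finite.mem_toFinset _).2 ⟨hu, h⟩, rfl⟩
    · intro t ht
      obtain ⟨p, _, rfl⟩ := Finset.mem_image.1 ht
      rfl
    · rw [pow_zero, mul_one, Set.ncard_eq_toFinset_card _]
      exact Finset.card_image_le
  | succ L ih =>
    obtain ⟨T, hT, hTL, hcard⟩ := ih
    let P := (linkedPairs H).toFinite.toFinset
    let D : Λ → Λ → Finset (Fin k → Λ) := fun x y => if x = y then ∅ else
      (Set.toFinite {e ∈ Set.univ.pi U | x ∈ Set.range e ∧ y ∈ Set.range e}).toFinset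
    have hD : ∀ x y, (D x y).card ≤ k ^ 2 * n ^ (k - 2) := by
      intro x y
      by_cases h : x = y
      · simp [D, h]
      · simp only [D, if_neg h]
        rw [← Set.ncard_eq_toFinset_card]
        exact ncard_edges_through_le hn h
    refine ⟨P.biUnion fun p => T.biUnion fun t => (D p.2 t.2.1).image fun e =>
      (e :: t.1, p.1, t.2.2), ?_, ?_, ?_⟩
    · intro l u v hl hlU hu hv ht
      cases ht with
      | nil h => simp at hl
      | @cons e l u x y v h hx hy hne hyH ht =>
        refine Finset.mem_biUnion.2 ⟨(u, x), (Set.Finite.mem_toFinset _).2 ⟨hu, h⟩,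
          Finset.mem_biUnion.2 ⟨(l, y, v), hT l y v (by simpa using hl)
            (fun e he => hlU e (List.mem_cons_of_mem _ he)) hyH hv ht,
            Finset.mem_image.2 ⟨e, ?_, rfl⟩⟩⟩
        simp only [D, if_neg hne, Set.Finite.mem_toFinset]
        exact ⟨hlU e List.mem_cons_self, hx, hy⟩
    · intro t ht
      simp only [Finset.mem_biUnion, Finset.mem_image] at ht
      obtain ⟨p, _, s, hs, e, _, rfl⟩ := ht
      simp [hTL s hs]
    · calc _ ≤ P.card * (T.card * (k ^ 2 * n ^ (k - 2))) :=
          Finset.card_biUnion_le_card_mul _ _ _ fun p _ =>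
            Finset.card_biUnion_le_card_mul _ _ _ fun t _ => Finset.card_image_le.trans (hD _ _)
        _ ≤ P.card * (((linkedPairs H).ncard *
            ((linkedPairs H).ncard * (k ^ 2 * n ^ (k - 2))) ^ L) * (k ^ 2 * n ^ (k - 2))) := by
          gcongr
        _ = _ := by
          have : P.card = (linkedPairs H).ncard := (Set.ncard_eq_toFinset_card _ _).symm
          rw [this]; ring

/-- There are at most `(k ^ 2 n ^ (k - 2) w) ^ (L + 1)` closed trails with `L + 1` hyperedges, one
factor `w` fewer than for trails in general, since the endpoint is determined by the start. -/
theorem exists_finset_closedTrail [Finite Λ] {n : ℕ} {U : Fin k → Set Λ}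
    (hn : ∀ i, (U i).ncard = n) (H : Set (Fin k → Λ)) (L : ℕ) :
    ∃ T : Finset (List (Fin k → Λ)),
      (∀ e l x y, l.length = L → (∀ f ∈ e :: l, f ∈ Set.univ.pi U) → x ∈ cover H → y ∈ cover H →
        x ≠ y → x ∈ Set.range e → y ∈ Set.range e → Trail H l y x → e :: l ∈ T) ∧
      (∀ t ∈ T, t.length = L + 1) ∧
      T.card ≤ ((linkedPairs H).ncard * (k ^ 2 * n ^ (k - 2))) ^ (L + 1) := by
  classical
  obtain ⟨T, hT, hTL, hcard⟩ := exists_finset_trail hn H L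
  let D : Λ → Λ → Finset (Fin k → Λ) := fun x y => if x = y then ∅ else
    (Set.toFinite {e ∈ Set.univ.pi U | x ∈ Set.range e ∧ y ∈ Set.range e}).toFinset
  have hD : ∀ x y, (D x y).card ≤ k ^ 2 * n ^ (k - 2) := by
    intro x y
    by_cases h : x = y
    · simp [D, h]
    · simp only [D, if_neg h]
      rw [← Set.ncard_eq_toFinset_card]
      exact ncard_edges_through_le hn h
  refine ⟨T.biUnion fun t => (D t.2.2 t.2.1).image fun e => e :: t.1, ?_, ?_, ?_⟩
  · intro e l x y hl hlU hx hy hne hxe hye ht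
    refine Finset.mem_biUnion.2 ⟨(l, y, x), hT l y x hl
      (fun f hf => hlU f (List.mem_cons_of_mem _ hf)) hy hx ht,
      Finset.mem_image.2 ⟨e, ?_, rfl⟩⟩
    simp only [D, if_neg hne, Set.Finite.mem_toFinset]
    exact ⟨hlU e List.mem_cons_self, hxe, hye⟩
  · intro t ht
    simp only [Finset.mem_biUnion, Finset.mem_image] at ht
    obtain ⟨s, hs, e, _, rfl⟩ := ht
    simp [hTL s hs]
  · calc _ ≤ T.card * (k ^ 2 * n ^ (k - 2)) :=
        Finset.card_biUnion_le_card_mul _ _ _ fun t _ => Finset.card_image_le.trans (hD _ _)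
      _ ≤ ((linkedPairs H).ncard *
          ((linkedPairs H).ncard * (k ^ 2 * n ^ (k - 2))) ^ L) * (k ^ 2 * n ^ (k - 2)) := by gcongr
      _ = _ := by ring

end Counting

/-! ### Matchings through prescribed hyperedges -/

section Matchings

variable {k N : ℕ} {Λ : Type*}

/-- The elements of the restricted domain of `z` whose support contains `T`. -/
def OmegaThrough (U : Fin k → Set Λ) (m : ℕ) (z : Labeling k N Λ) (T : Set (Fin k → Λ)) :
    Set (Labeling k N Λ) :=
  {y | y ∈ OmegaRestrict U m z ∧ T ⊆ supp y}

instance [NeZero N] [Finite Λ] : Finite (Labeling k N Λ) :=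
  inferInstanceAs (Finite ((Fin k → Λ) → Option (Fin k → ZMod N)))

theorem comp_perm_mem_Omega [Finite Λ] {U : Fin k → Set Λ} {m : ℕ} {y : Labeling k N Λ}
    (hy : y ∈ Omega N U m) (σ : Equiv.Perm Λ) (hσ : ∀ i x, σ x ∈ U i → x ∈ U i) :
    (fun f => y (σ ∘ f)) ∈ Omega N U m := by
  obtain ⟨hyU, hyM, -, hym⟩ := hy
  have hpre : supp (fun f => y (σ ∘ f)) = (fun f : Fin k → Λ => σ ∘ f) ⁻¹' supp y := rfl
  have hbij : Function.Bijective fun f : Fin k → Λ => σ ∘ f :=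
    (Equiv.arrowCongr (Equiv.refl (Fin k)) σ).bijective
  refine ⟨fun f hf i _ => hσ i _ (hyU hf i (Set.mem_univ i)), ?_, Set.toFinite _, ?_⟩
  · rw [isMatching_iff] at hyM ⊢
    intro e he f hf x ⟨i, hi⟩ ⟨j, hj⟩
    exact hbij.injective (hyM _ he _ hf (σ x) ⟨i, by simp [hi]⟩ ⟨j, by simp [hj]⟩)
  · rw [hpre, Set.ncard_preimage_of_injective_subset_range hbij.injective (by
      rw [hbij.surjective.range_eq]; exact Set.subset_univ _), hym]

/-- Exchanging one vertex of `e` for another free vertex in the same part does not change the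
number of matchings through `e`. -/
theorem ncard_OmegaThrough_update_le [NeZero N] [Finite Λ] {U : Fin k → Set Λ}
    (hU : Pairwise fun i j => Disjoint (U i) (U j)) {m : ℕ} {z : Labeling k N Λ}
    {T : Set (Fin k → Λ)} (hz : supp z ⊆ T) {e : Fin k → Λ} (he : e ∈ Set.univ.pi U) (i : Fin k)
    (hei : e i ∉ cover T) {u : Λ} (hu : u ∈ U i) (huT : u ∉ cover T) :
    (OmegaThrough U m z (insert e T)).ncard ≤
      (OmegaThrough U m z (insert (Function.update e i u) T)).ncard := by
  classical
  let τ : Equiv.Perm Λ := Equiv.swap (e i) u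
  have hei' : e i ∈ U i := he i (Set.mem_univ i)
  have hτU : ∀ j x, τ x ∈ U j → x ∈ U j := by
    intro j x hx
    rcases eq_or_ne x (e i) with rfl | h₁
    · rw [Equiv.swap_apply_left] at hx
      exact mem_part_unique hU hu hx ▸ hei'
    · rcases eq_or_ne x u with rfl | h₂
      · rw [Equiv.swap_apply_right] at hx
        exact mem_part_unique hU hei' hx ▸ hu
      · rwa [Equiv.swap_apply_of_ne_of_ne h₁ h₂] at hx
  have hfix : ∀ f ∈ T, τ ∘ f = f := by
    intro f hf
    funext j
    have hfj : f j ∈ cover T := mem_cover.2 ⟨f, hf, Set.mem_range_self j⟩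
    exact Equiv.swap_apply_of_ne_of_ne (fun h => hei (h ▸ hfj)) (fun h => huT (h ▸ hfj))
  have hmap : τ ∘ Function.update e i u = e := by
    funext j
    rcases eq_or_ne j i with rfl | hj
    · simp [τ]
    · simp only [Function.comp, Function.update_of_ne hj]
      have hej := he j (Set.mem_univ j)
      exact Equiv.swap_apply_of_ne_of_ne (fun h => hj (mem_part_unique hU hej (h ▸ hei')))
        (fun h => hj (mem_part_unique hU hej (h ▸ hu)))
  refine Set.ncard_le_ncard_of_injOn (fun y f => y (τ ∘ f)) ?_ ?_
  · rintro y ⟨⟨hy, hyz⟩, hyT⟩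
    refine ⟨⟨comp_perm_mem_Omega hy τ hτU, fun f hf => ?_⟩, ?_⟩
    · simp only [hfix f (hz hf)]
      exact hyz f hf
    · rintro f (rfl | hf)
      · change y (τ ∘ Function.update e i u) ≠ none
        rw [hmap]
        exact hyT (Set.mem_insert _ _)
      · change y (τ ∘ f) ≠ none
        rw [hfix f hf]
        exact hyT (Set.mem_insert_of_mem _ hf)
  · intro y _ y' _ h
    funext f
    have := congrFun h (τ ∘ f)
    simpa [← Function.comp_assoc, τ, Equiv.swap_comp_apply, Function.comp_def] using this

theorem ncard_OmegaThrough_insert_le_of_free [NeZero N] [Finite Λ] {U : Fin k → Set Λ}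
    (hU : Pairwise fun i j => Disjoint (U i) (U j)) {m : ℕ} {z : Labeling k N Λ}
    {T : Set (Fin k → Λ)} (hz : supp z ⊆ T) {e e' : Fin k → Λ}
    (he : e ∈ Set.univ.pi fun i => U i \ cover T)
    (he' : e' ∈ Set.univ.pi fun i => U i \ cover T) :
    (OmegaThrough U m z (insert e T)).ncard ≤ (OmegaThrough U m z (insert e' T)).ncard := by
  classical
  have key : ∀ s : Finset (Fin k), (OmegaThrough U m z (insert e T)).ncard ≤
      (OmegaThrough U m z (insert (s.piecewise e' e) T)).ncard := by
    intro s
    induction s using Finset.induction_on with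
    | empty => simp
    | insert i s hi ih =>
      rw [Finset.piecewise_insert]
      have hmem : ∀ j, s.piecewise e' e j ∈ U j \ cover T := by
        intro j
        by_cases h : j ∈ s
        · rw [Finset.piecewise_eq_of_mem _ _ _ h]; exact he' j (Set.mem_univ j)
        · rw [Finset.piecewise_eq_of_notMem _ _ _ h]; exact he j (Set.mem_univ j)
      have hi' := he' i (Set.mem_univ i)
      exact ih.trans (ncard_OmegaThrough_update_le hU hz (fun j _ => (hmem j).1) i (hmem i).2
        hi'.1 hi'.2)
  simpa using key Finset.univ

theorem sub_ncard_le_ncard_diff_cover [Finite Λ] {n : ℕ} {U : Fin k → Set Λ}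
    (hU : Pairwise fun i j => Disjoint (U i) (U j)) (hn : ∀ i, (U i).ncard = n)
    {T : Set (Fin k → Λ)} (hT : T ⊆ Set.univ.pi U) (i : Fin k) :
    n - T.ncard ≤ (U i \ cover T).ncard := by
  have hsub : U i ⊆ (U i \ cover T) ∪ (fun e : Fin k → Λ => e i) '' T := by
    intro x hx
    by_cases hxT : x ∈ cover T
    · obtain ⟨e, he, j, rfl⟩ := mem_cover.1 hxT
      have : j = i := mem_part_unique hU (hT he j (Set.mem_univ j)) hx
      exact .inr ⟨e, he, by rw [this]⟩
    · exact .inl ⟨hx, hxT⟩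
  have h₁ := Set.ncard_le_ncard hsub
  have h₂ := Set.ncard_union_le (U i \ cover T) ((fun e : Fin k → Λ => e i) '' T)
  have h₃ : ((fun e : Fin k → Λ => e i) '' T).ncard ≤ T.ncard := Set.ncard_image_le
  rw [hn] at h₁
  omega

/-- Prescribing one more hyperedge divides the number of matchings by at least
`(n - m) ^ (k - 1)`. By symmetry all free hyperedges are contained in equally many matchings, so
that the bound follows by double counting. -/
theorem ncard_OmegaThrough_insert_mul_le [NeZero N] [Finite Λ] {n : ℕ} (hk : 1 ≤ k)
    {U : Fin k → Set Λ}
    (hU : Pairwise fun i j => Disjoint (U i) (U j)) (hn : ∀ i, (U i).ncard = n) {m : ℕ}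
    (hm : m ≤ n) {z : Labeling k N Λ} {T : Set (Fin k → Λ)} (hz : supp z ⊆ T) {e : Fin k → Λ}
    (heT : e ∉ T) :
    (OmegaThrough U m z (insert e T)).ncard * (n - m) ^ (k - 1) ≤
      (OmegaThrough U m z T).ncard := by
  classical
  rcases (OmegaThrough U m z (insert e T)).eq_empty_or_nonempty with h0 | ⟨y₀, ⟨hy₀, -⟩, hy₀T⟩
  · simp [h0]
  obtain ⟨hy₀U, hy₀M, -, hy₀m⟩ := hy₀
  rw [isMatching_iff] at hy₀M
  have hTU : T ⊆ Set.univ.pi U := fun f hf => hy₀U (hy₀T (Set.mem_insert_of_mem _ hf))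
  have htm : T.ncard < m := by
    have := Set.ncard_le_ncard hy₀T
    rw [Set.ncard_insert_of_notMem heT] at this
    omega
  have heFree : e ∈ Set.univ.pi fun i => U i \ cover T := by
    intro i _
    refine ⟨hy₀U (hy₀T (Set.mem_insert _ _)) i (Set.mem_univ i), fun hc => ?_⟩
    obtain ⟨f, hf, hif⟩ := mem_cover.1 hc
    exact heT (hy₀M e (hy₀T (Set.mem_insert _ _)) f (hy₀T (Set.mem_insert_of_mem _ hf)) _
      (Set.mem_range_self i) hif ▸ hf)
  have : Fintype Λ := Fintype.ofFinite Λ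
  let Free : Finset (Fin k → Λ) := Fintype.piFinset fun i => (U i \ cover T).toFinset
  have hFree : ∀ f ∈ Free, f ∈ Set.univ.pi fun i => U i \ cover T := by
    intro f hf i _
    simpa using Fintype.mem_piFinset.1 hf i
  have hFreeCard : (n - T.ncard) ^ k ≤ Free.card := by
    rw [Fintype.card_piFinset]
    calc (n - T.ncard) ^ k = ∏ _i : Fin k, (n - T.ncard) := by simp
      _ ≤ _ := Finset.prod_le_prod' fun i _ => by
        rw [← Set.ncard_eq_toFinset_card']
        exact sub_ncard_le_ncard_diff_cover hU hn hTU i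
  let Y : Finset (Labeling k N Λ) := (OmegaThrough U m z T).toFinite.toFinset
  have hcount : ∑ f ∈ Free, (Y.filter fun y => f ∈ supp y).card ≤ Y.card * (m - T.ncard) := by
    have hdouble : ∑ f ∈ Free, (Y.filter fun y => f ∈ supp y).card =
        ∑ y ∈ Y, (Free.filter fun f => f ∈ supp y).card :=
      Finset.sum_card_bipartiteAbove_eq_sum_card_bipartiteBelow (fun f y => f ∈ supp y)
    rw [hdouble]
    refine Finset.sum_le_card_nsmul _ _ _ fun y hy => ?_
    obtain ⟨⟨hy, -⟩, hyT⟩ := (Set.Finite.mem_toFinset _).1 hy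
    have hsub : ((Free.filter fun f => f ∈ supp y : Finset _) : Set (Fin k → Λ)) ⊆ supp y \ T := by
      intro f hf
      obtain ⟨hf, hfy⟩ := Finset.mem_filter.1 hf
      exact ⟨hfy, fun hfT => (hFree f hf ⟨0, hk⟩ (Set.mem_univ _)).2
        (mem_cover.2 ⟨f, hfT, Set.mem_range_self _⟩)⟩
    rw [← Set.ncard_coe_finset]
    refine (Set.ncard_le_ncard hsub).trans ?_
    rw [Set.ncard_sdiff hyT, hy.2.2.2]
  have hmain : (OmegaThrough U m z (insert e T)).ncard * (n - T.ncard) ^ k ≤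
      (OmegaThrough U m z T).ncard * (n - T.ncard) := by
    calc (OmegaThrough U m z (insert e T)).ncard * (n - T.ncard) ^ k
        ≤ (OmegaThrough U m z (insert e T)).ncard * Free.card := Nat.mul_le_mul_left _ hFreeCard
      _ = ∑ _f ∈ Free, (OmegaThrough U m z (insert e T)).ncard := by simp [mul_comm]
      _ ≤ ∑ f ∈ Free, (Y.filter fun y => f ∈ supp y).card := by
        refine Finset.sum_le_sum fun f hf => ?_
        refine (ncard_OmegaThrough_insert_le_of_free hU hz heFree (hFree f hf)).trans ?_
        rw [← Set.ncard_coe_finset]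
        refine Set.ncard_le_ncard fun y hy => ?_
        refine Finset.mem_coe.2 (Finset.mem_filter.2 ⟨(Set.Finite.mem_toFinset _).2 ⟨hy.1,
          (Set.subset_insert _ _).trans hy.2⟩, hy.2 (Set.mem_insert _ _)⟩)
      _ ≤ Y.card * (m - T.ncard) := hcount
      _ ≤ _ := by
        rw [← Set.ncard_eq_toFinset_card]
        exact Nat.mul_le_mul_left _ (Nat.sub_le_sub_right hm _)
  have hpos : 0 < n - T.ncard := by omega
  have hpow : (n - T.ncard) ^ k = (n - T.ncard) ^ (k - 1) * (n - T.ncard) := by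
    rw [← pow_succ, Nat.sub_add_cancel hk]
  rw [hpow, ← mul_assoc] at hmain
  refine le_trans ?_ (Nat.le_of_mul_le_mul_right hmain hpos)
  exact Nat.mul_le_mul_left _ (Nat.pow_le_pow_left (by omega) _)

theorem ncard_OmegaThrough_union_mul_le [NeZero N] [Finite Λ] {n : ℕ} (hk : 1 ≤ k)
    {U : Fin k → Set Λ}
    (hU : Pairwise fun i j => Disjoint (U i) (U j)) (hn : ∀ i, (U i).ncard = n) {m : ℕ}
    (hm : m ≤ n) {z : Labeling k N Λ} (D : Finset (Fin k → Λ)) (hD : ∀ e ∈ D, e ∉ supp z) :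
    (OmegaThrough U m z (supp z ∪ D)).ncard * ((n - m) ^ (k - 1)) ^ D.card ≤
      (OmegaRestrict U m z).ncard := by
  classical
  induction D using Finset.induction_on with
  | empty => simpa using Set.ncard_le_ncard fun y hy => hy.1
  | insert e D he ih =>
    have h := ncard_OmegaThrough_insert_mul_le (U := U) (n := n) (m := m) (z := z)
      (T := supp z ∪ D) hk hU hn hm Set.subset_union_left (e := e) (by
        rintro (h | h)
        · exact hD e (Finset.mem_insert_self _ _) h
        · exact he h)
    rw [Finset.coe_insert, Set.union_insert, Finset.card_insert_of_notMem he, pow_succ',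
      ← mul_assoc]
    exact (Nat.mul_le_mul_right _ h).trans
      (ih fun f hf => hD f (Finset.mem_insert_of_mem hf))

/-- In a global set, prescribed hyperedges are as unlikely as in the full domain, up to a factor of
`2` for each hyperedge. Globality is applied to the restrictions that prescribe a label for each of
these hyperedges, and the bounds are added up over all labels. -/
theorem IsGlobal.ncard_through_mul_le [NeZero N] [Finite Λ] {n : ℕ} (hk : 1 ≤ k)
    {U : Fin k → Set Λ}
    (hU : Pairwise fun i j => Disjoint (U i) (U j)) (hn : ∀ i, (U i).ncard = n) {m : ℕ}
    (hm : m ≤ n) {z : Labeling k N Λ} {A : Set (Labeling k N Λ)}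
    (hA : IsGlobal U m z A) (D : Finset (Fin k → Λ)) (hD : ∀ e ∈ D, e ∉ supp z) :
    ({y ∈ A | (D : Set (Fin k → Λ)) ⊆ supp y}.ncard : ℝ) * (((n - m : ℕ) : ℝ) ^ (k - 1)) ^ D.card ≤
      2 ^ D.card * A.ncard := by
  classical
  obtain ⟨hAz, hglob⟩ := hA
  let T : Set (Fin k → Λ) := supp z ∪ D
  -- `ρ` restricts a labeled matching to `T`.
  let ρ : Labeling k N Λ → Labeling k N Λ := fun y f => if f ∈ T then y f else none
  let X : Finset (Labeling k N Λ) :=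
    (Set.toFinite {y ∈ A | (D : Set (Fin k → Λ)) ⊆ supp y}).toFinset
  let Y : Finset (Labeling k N Λ) := (OmegaThrough U m z T).toFinite.toFinset
  have hXmem : ∀ y ∈ X, y ∈ A ∧ y ∈ OmegaRestrict U m z ∧ T ⊆ supp y := by
    intro y hy
    obtain ⟨hyA, hyD⟩ := (Set.Finite.mem_toFinset _).1 hy
    have hyz := hAz hyA
    refine ⟨hyA, hyz, Set.union_subset (fun f hf => ?_) hyD⟩
    change y f ≠ none
    rw [hyz.2 f hf]
    exact hf
  let Z := X.image ρ
  have hfib : ∀ z' ∈ Z, ((X.filter fun y => ρ y = z').card : ℝ) ≤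
      2 ^ D.card * (A.ncard / (OmegaRestrict U m z).ncard) *
        ((Y.filter fun y => ρ y = z').card : ℝ) := by
    intro z' hz'
    obtain ⟨y₀, hy₀, rfl⟩ := Finset.mem_image.1 hz'
    obtain ⟨hy₀A, ⟨hy₀Ω, hy₀z⟩, hy₀T⟩ := hXmem y₀ hy₀
    have hsupp : supp (ρ y₀) = T := by
      ext f
      change (if f ∈ T then y₀ f else none) ≠ none ↔ f ∈ T
      by_cases hf : f ∈ T
      · rw [if_pos hf]
        exact ⟨fun _ => hf, fun _ => hy₀T hf⟩
      · simp [hf]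
    have hrestr : ρ y₀ ∈ Restrictions N U m := by
      refine ⟨T.ncard, ?_, ?_, ?_, Set.toFinite _, by rw [hsupp]⟩
      · rw [← hy₀Ω.2.2.2]
        exact Set.ncard_le_ncard hy₀T
      · rw [hsupp]; exact hy₀T.trans hy₀Ω.1
      · rw [hsupp]; exact hy₀Ω.2.1.subset hy₀T
    have hsubs : Subsumes (ρ y₀) z := by
      refine ⟨hsupp ▸ Set.subset_union_left, fun f hf => ?_⟩
      simp only [ρ, T, Set.mem_union, hf, true_or, if_true]
      exact (hy₀z f hf).symm
    have hg := hglob _ hrestr hsubs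
    have hcardT : T.ncard - (supp z).ncard = D.card := by
      rw [Set.ncard_union_eq (Set.disjoint_left.2 fun f hf hfD => hD f hfD hf)]
      simp
    rw [hsupp, hcardT] at hg
    -- the fibres of `ρ` are the parts in the restricted domain
    have hX : (X.filter fun y => ρ y = ρ y₀).card ≤ (A ∩ OmegaRestrict U m (ρ y₀)).ncard := by
      rw [← Set.ncard_coe_finset]
      refine Set.ncard_le_ncard fun y hy => ?_
      obtain ⟨hyX, hyρ⟩ := Finset.mem_filter.1 hy
      obtain ⟨hyA, hyz, -⟩ := hXmem y hyX
      refine ⟨hyA, hyz.1, fun f hf => ?_⟩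
      rw [hsupp] at hf
      rw [← hyρ]
      simp [ρ, hf]
    have hY : (OmegaRestrict U m (ρ y₀)).ncard ≤ (Y.filter fun y => ρ y = ρ y₀).card := by
      rw [← Set.ncard_coe_finset]
      refine Set.ncard_le_ncard fun y hy => ?_
      have hyT : T ⊆ supp y := by
        intro f hf
        change y f ≠ none
        rw [hy.2 f (hsupp ▸ hf)]
        exact (hsupp ▸ hf : f ∈ supp (ρ y₀))
      refine Finset.mem_coe.2 (Finset.mem_filter.2 ⟨(Set.Finite.mem_toFinset _).2 ⟨⟨hy.1, ?_⟩,
        hyT⟩, ?_⟩)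
      · intro f hf
        rw [hy.2 f (hsubs.1 hf), hsubs.2 f hf]
      · funext f
        by_cases hf : f ∈ T
        · have := hy.2 f (hsupp ▸ hf)
          simpa [ρ, hf] using this
        · simp [ρ, hf]
    have hAΩ : A ∩ OmegaRestrict U m z = A := Set.inter_eq_left.2 hAz
    unfold density at hg
    rw [hAΩ] at hg
    have hpos : 0 < (OmegaRestrict U m (ρ y₀)).ncard := by
      rw [Set.ncard_pos]
      refine ⟨y₀, hy₀Ω, fun f hf => ?_⟩
      rw [hsupp] at hf
      simp [ρ, hf]
    rw [div_le_iff₀ (by exact_mod_cast hpos)] at hg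
    calc ((X.filter fun y => ρ y = ρ y₀).card : ℝ)
        ≤ (A ∩ OmegaRestrict U m (ρ y₀)).ncard := by exact_mod_cast hX
      _ ≤ _ := hg
      _ ≤ _ := by
        gcongr
  have hXsum : (X.card : ℝ) = ∑ z' ∈ Z, ((X.filter fun y => ρ y = z').card : ℝ) := by
    exact_mod_cast Finset.card_eq_sum_card_fiberwise fun y hy => Finset.mem_image_of_mem ρ hy
  have hYsum : ∑ z' ∈ Z, ((Y.filter fun y => ρ y = z').card : ℝ) ≤ Y.card := by
    have : ∑ z' ∈ Z, (Y.filter fun y => ρ y = z').card ≤ Y.card := by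
      rw [← Finset.card_biUnion]
      · exact Finset.card_le_card (Finset.biUnion_subset.2 fun z' _ => Finset.filter_subset _ _)
      · intro a _ b _ hab
        exact Finset.disjoint_left.2 fun y hy hy' =>
          hab ((Finset.mem_filter.1 hy).2.symm.trans (Finset.mem_filter.1 hy').2)
    exact_mod_cast this
  have hXY : (X.card : ℝ) ≤ 2 ^ D.card * (A.ncard / (OmegaRestrict U m z).ncard) * Y.card := by
    rw [hXsum]
    calc _ ≤ ∑ z' ∈ Z, 2 ^ D.card * ((A.ncard : ℝ) / (OmegaRestrict U m z).ncard) *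
        ((Y.filter fun y => ρ y = z').card : ℝ) := Finset.sum_le_sum hfib
      _ ≤ _ := by rw [← Finset.mul_sum]; gcongr
  have hYcount : (Y.card : ℝ) * (((n - m : ℕ) : ℝ) ^ (k - 1)) ^ D.card ≤
      (OmegaRestrict U m z).ncard := by
    have := ncard_OmegaThrough_union_mul_le hk hU hn hm D hD
    rw [Set.ncard_eq_toFinset_card (OmegaThrough U m z (supp z ∪ D))] at this
    exact_mod_cast this
  rw [Set.ncard_eq_toFinset_card]
  calc (X.card : ℝ) * (((n - m : ℕ) : ℝ) ^ (k - 1)) ^ D.card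
      ≤ 2 ^ D.card * (A.ncard / (OmegaRestrict U m z).ncard) * Y.card *
        (((n - m : ℕ) : ℝ) ^ (k - 1)) ^ D.card := by gcongr
    _ = 2 ^ D.card * (A.ncard / (OmegaRestrict U m z).ncard) *
        (Y.card * (((n - m : ℕ) : ℝ) ^ (k - 1)) ^ D.card) := by ring
    _ ≤ 2 ^ D.card * (A.ncard / (OmegaRestrict U m z).ncard) *
        (OmegaRestrict U m z).ncard := by gcongr
    _ ≤ 2 ^ D.card * A.ncard := by
      rw [mul_assoc]
      gcongr
      rcases eq_or_ne ((OmegaRestrict U m z).ncard : ℝ) 0 with h | h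
      · simp [h]
      · rw [div_mul_cancel₀ _ h]

end Matchings

/-! ### Random elements of global sets -/

section Expectation

variable {k N : ℕ} {Λ : Type*}

theorem sum_range_pow_le_two {ρ : ℝ} (h0 : 0 ≤ ρ) (h : ρ ≤ 1 / 2) (M : ℕ) :
    ∑ L ∈ Finset.range M, ρ ^ L ≤ 2 :=
  (Finset.sum_le_sum fun L _ => pow_le_pow_left₀ h0 h L).trans (sum_geometric_two_le M)

/-- The hyperedges of `y` that are not prescribed by the restriction `z`. -/
def fresh (z y : Labeling k N Λ) : Set (Fin k → Λ) :=
  supp y \ supp z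

theorem IsGlobal.ncard_list_le [NeZero N] [Finite Λ] {n m : ℕ} (hk : 1 ≤ k)
    {U : Fin k → Set Λ} (hU : Pairwise fun i j => Disjoint (U i) (U j))
    (hn : ∀ i, (U i).ncard = n) (hm : m < n) {z : Labeling k N Λ} {A : Set (Labeling k N Λ)}
    (hA : IsGlobal U m z A) {l : List (Fin k → Λ)} (hl : l.Nodup) :
    ({y ∈ A | ∀ e ∈ l, e ∈ fresh z y}.ncard : ℝ) ≤
      (2 / ((n - m : ℕ) : ℝ) ^ (k - 1)) ^ l.length * A.ncard := by
  classical
  by_cases hz : ∀ e ∈ l, e ∉ supp z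
  · have h := hA.ncard_through_mul_le hk hU hn hm.le l.toFinset (by simpa using hz)
    rw [List.toFinset_card_of_nodup hl] at h
    have hsub : {y ∈ A | ∀ e ∈ l, e ∈ fresh z y} ⊆
        {y ∈ A | ((l.toFinset : Finset _) : Set (Fin k → Λ)) ⊆ supp y} := by
      rintro y ⟨hy, hyl⟩
      exact ⟨hy, fun e he => (hyl e (by simpa using he)).1⟩
    have hpos : (0 : ℝ) < ((n - m : ℕ) : ℝ) ^ (k - 1) := by
      have : 0 < n - m := by omega
      positivity
    rw [div_pow, div_mul_eq_mul_div, le_div_iff₀ (by positivity)]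
    refine le_trans ?_ h
    gcongr
    exact Set.toFinite _
  · push Not at hz
    obtain ⟨e, he, hez⟩ := hz
    have : {y ∈ A | ∀ e ∈ l, e ∈ fresh z y} = ∅ := by
      ext y
      simp only [Set.mem_ofPred_eq, Set.mem_empty_iff_false, iff_false, not_and]
      exact fun _ h => (h e he).2 hez
    rw [this]
    simp only [Set.ncard_empty, Nat.cast_zero]
    positivity

theorem fresh_matching {U : Fin k → Set Λ} {m : ℕ} {z y : Labeling k N Λ}
    (hy : y ∈ Omega N U m) : ∀ e ∈ fresh z y, ∀ f ∈ fresh z y, ∀ x, x ∈ Set.range e →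
      x ∈ Set.range f → e = f :=
  fun e he f hf => isMatching_iff.1 hy.2.1 e he.1 f hf.1

theorem length_le_of_forall_mem_fresh [Finite Λ] {U : Fin k → Set Λ} {m : ℕ}
    {z y : Labeling k N Λ} (hy : y ∈ Omega N U m) {l : List (Fin k → Λ)} (hl : l.Nodup)
    (hly : ∀ e ∈ l, e ∈ fresh z y) : l.length ≤ m := by
  classical
  rw [← hy.2.2.2, ← List.toFinset_card_of_nodup hl, ← Set.ncard_coe_finset]
  exact Set.ncard_le_ncard fun e he => (hly e (by simpa using he)).1

/-- The expected number of pairs of vertices covered by `H` that get linked when the fresh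
hyperedges of a random element of the global set `A` are added is at most twice the number of
pairs that were linked before. The number `ρ` bounds the growth rate of the expected number of
trails. -/
theorem IsGlobal.sum_mergedPairs_le [NeZero N] [Finite Λ] {n m : ℕ} (hk : 1 ≤ k)
    {U : Fin k → Set Λ} (hU : Pairwise fun i j => Disjoint (U i) (U j))
    (hn : ∀ i, (U i).ncard = n) (hm : m < n) {z : Labeling k N Λ} {A : Set (Labeling k N Λ)}
    (hA : IsGlobal U m z A) (H : Set (Fin k → Λ)) {ρ : ℝ} (hρ0 : 0 ≤ ρ) (hρ : ρ ≤ 1 / 2)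
    (hHρ : 2 * ((linkedPairs H).ncard * ((k : ℝ) ^ 2 * (n : ℝ) ^ (k - 2))) ≤
      ρ * ((n - m : ℕ) : ℝ) ^ (k - 1)) :
    ∑ y ∈ A.toFinite.toFinset, ((mergedPairs H (fresh z y)).ncard : ℝ) ≤
      2 * (linkedPairs H).ncard * A.ncard := by
  classical
  choose T hT hTL hTcard using exists_finset_trail (U := U) hn H
  let good : Labeling k N Λ → List (Fin k → Λ) × Λ × Λ → Prop := fun y t =>
    t.1.Nodup ∧ ∀ e ∈ t.1, e ∈ fresh z y
  have hpos : (0 : ℝ) < ((n - m : ℕ) : ℝ) ^ (k - 1) := by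
    have : 0 < n - m := by omega
    positivity
  have h₁ : ∀ y ∈ A.toFinite.toFinset, (mergedPairs H (fresh z y)).ncard ≤
      ∑ L ∈ Finset.range (m + 1), ((T L).filter (good y)).card := by
    intro y hy
    have hyΩ := (hA.1 ((Set.Finite.mem_toFinset _).1 hy)).1
    have hsub : mergedPairs H (fresh z y) ⊆ (((Finset.range (m + 1)).biUnion fun L =>
        ((T L).filter (good y)).image Prod.snd : Finset (Λ × Λ)) : Set (Λ × Λ)) := by
      rintro ⟨u, v⟩ ⟨hu, hv, hlink⟩
      obtain ⟨l, hl, hly, ht⟩ := exists_trail (fresh_matching hyΩ) hv hlink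
      have hlen := length_le_of_forall_mem_fresh hyΩ hl hly
      refine Finset.mem_coe.2 (Finset.mem_biUnion.2 ⟨l.length, by simpa using by omega,
        Finset.mem_image.2 ⟨(l, u, v), Finset.mem_filter.2 ⟨?_, hl, hly⟩, rfl⟩⟩)
      exact hT _ l u v rfl (fun e he => hyΩ.1 (hly e he).1) hu hv ht
    calc _ ≤ _ := Set.ncard_le_ncard hsub
      _ ≤ _ := by
        rw [Set.ncard_coe_finset]
        exact Finset.card_biUnion_le.trans (Finset.sum_le_sum fun L _ => Finset.card_image_le)
  have h₂ : ∀ L, ∑ y ∈ A.toFinite.toFinset, (((T L).filter (good y)).card : ℝ) ≤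
      (linkedPairs H).ncard * A.ncard * ρ ^ L := by
    intro L
    have hswap : ∑ y ∈ A.toFinite.toFinset, ((T L).filter (good y)).card =
        ∑ t ∈ T L, (A.toFinite.toFinset.filter fun y => good y t).card :=
      Finset.sum_card_bipartiteAbove_eq_sum_card_bipartiteBelow good
    have hprob : ∀ t ∈ T L, ((A.toFinite.toFinset.filter fun y => good y t).card : ℝ) ≤
        (2 / ((n - m : ℕ) : ℝ) ^ (k - 1)) ^ L * A.ncard := by
      intro t ht
      by_cases hnd : t.1.Nodup
      · rw [← hTL L t ht]
        refine le_trans ?_ (hA.ncard_list_le hk hU hn hm hnd)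
        rw [← Set.ncard_coe_finset]
        refine Nat.cast_le.2 (Set.ncard_le_ncard fun y hy => ?_)
        obtain ⟨hyA, -, hy⟩ := Finset.mem_filter.1 hy
        exact ⟨(Set.Finite.mem_toFinset _).1 hyA, hy⟩
      · have : (A.toFinite.toFinset.filter fun y => good y t) = ∅ :=
          Finset.filter_eq_empty_iff.2 fun y _ h => hnd h.1
        rw [this]
        simp only [Finset.card_empty, Nat.cast_zero]
        positivity
    calc ∑ y ∈ A.toFinite.toFinset, (((T L).filter (good y)).card : ℝ)
        = ∑ t ∈ T L, ((A.toFinite.toFinset.filter fun y => good y t).card : ℝ) := by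
          exact_mod_cast hswap
      _ ≤ (T L).card * ((2 / ((n - m : ℕ) : ℝ) ^ (k - 1)) ^ L * A.ncard) := by
          rw [← nsmul_eq_mul]; exact Finset.sum_le_card_nsmul _ _ _ hprob
      _ ≤ ((linkedPairs H).ncard * ((linkedPairs H).ncard *
            ((k : ℝ) ^ 2 * (n : ℝ) ^ (k - 2))) ^ L) *
            ((2 / ((n - m : ℕ) : ℝ) ^ (k - 1)) ^ L * A.ncard) := by
          gcongr
          exact_mod_cast hTcard L
      _ = (linkedPairs H).ncard * A.ncard * (2 * ((linkedPairs H).ncard *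
            ((k : ℝ) ^ 2 * (n : ℝ) ^ (k - 2))) / ((n - m : ℕ) : ℝ) ^ (k - 1)) ^ L := by
          rw [div_pow, div_pow, mul_pow 2]; ring
      _ ≤ _ := by
          gcongr
          rwa [div_le_iff₀ hpos]
  calc ∑ y ∈ A.toFinite.toFinset, ((mergedPairs H (fresh z y)).ncard : ℝ)
      ≤ ∑ y ∈ A.toFinite.toFinset, ∑ L ∈ Finset.range (m + 1),
          (((T L).filter (good y)).card : ℝ) :=
        Finset.sum_le_sum fun y hy => by exact_mod_cast h₁ y hy
    _ = ∑ L ∈ Finset.range (m + 1), ∑ y ∈ A.toFinite.toFinset,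
          (((T L).filter (good y)).card : ℝ) := Finset.sum_comm
    _ ≤ ∑ L ∈ Finset.range (m + 1), (linkedPairs H).ncard * A.ncard * ρ ^ L :=
        Finset.sum_le_sum fun L _ => h₂ L
    _ ≤ (linkedPairs H).ncard * A.ncard * 2 := by
        rw [← Finset.mul_sum]
        gcongr
        exact sum_range_pow_le_two hρ0 hρ _
    _ = _ := by ring

/-- A random element of the global set `A` closes a trail with probability at most `2 ρ`. -/
theorem IsGlobal.ncard_hasClosedTrail_le [NeZero N] [Finite Λ] {n m : ℕ} (hk : 1 ≤ k)
    {U : Fin k → Set Λ} (hU : Pairwise fun i j => Disjoint (U i) (U j))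
    (hn : ∀ i, (U i).ncard = n) (hm : m < n) {z : Labeling k N Λ} {A : Set (Labeling k N Λ)}
    (hA : IsGlobal U m z A) (H : Set (Fin k → Λ)) {ρ : ℝ} (hρ0 : 0 ≤ ρ) (hρ : ρ ≤ 1 / 2)
    (hHρ : 2 * ((linkedPairs H).ncard * ((k : ℝ) ^ 2 * (n : ℝ) ^ (k - 2))) ≤
      ρ * ((n - m : ℕ) : ℝ) ^ (k - 1)) :
    ({y ∈ A | HasClosedTrail H (fresh z y)}.ncard : ℝ) ≤ 2 * ρ * A.ncard := by
  classical
  choose T hT hTL hTcard using exists_finset_closedTrail (U := U) hn H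
  have hpos : (0 : ℝ) < ((n - m : ℕ) : ℝ) ^ (k - 1) := by
    have : 0 < n - m := by omega
    positivity
  let B : List (Fin k → Λ) → Finset (Labeling k N Λ) := fun l =>
    if l.Nodup then (Set.toFinite {y ∈ A | ∀ e ∈ l, e ∈ fresh z y}).toFinset else ∅
  have hB : ∀ L, ∀ l ∈ T L, ((B l).card : ℝ) ≤
      (2 / ((n - m : ℕ) : ℝ) ^ (k - 1)) ^ (L + 1) * A.ncard := by
    intro L l hl
    by_cases hnd : l.Nodup
    · have := hA.ncard_list_le hk hU hn hm hnd
      rw [hTL L l hl, Set.ncard_eq_toFinset_card _] at this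
      simpa only [B, if_pos hnd] using this
    · simp only [B, if_neg hnd, Finset.card_empty, Nat.cast_zero]
      positivity
  have hsub : {y ∈ A | HasClosedTrail H (fresh z y)} ⊆
      (((Finset.range (m + 1)).biUnion fun L => (T L).biUnion B : Finset _) :
        Set (Labeling k N Λ)) := by
    rintro y ⟨hyA, e, l, x, x', hne, hx, hx', hxH, hxH', hnd, hly, ht⟩
    have hyΩ := (hA.1 hyA).1
    have hlen := length_le_of_forall_mem_fresh hyΩ hnd hly
    refine Finset.mem_coe.2 (Finset.mem_biUnion.2 ⟨l.length, ?_, Finset.mem_biUnion.2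
      ⟨e :: l, ?_, ?_⟩⟩)
    · simp only [List.length_cons] at hlen
      simp only [Finset.mem_range]
      omega
    · exact hT _ e l x x' rfl (fun f hf => hyΩ.1 (hly f hf).1) hxH hxH' hne hx hx' ht
    · simp only [B, if_pos hnd, Set.Finite.mem_toFinset]
      exact ⟨hyA, hly⟩
  have hL : ∀ L, ∑ l ∈ T L, ((B l).card : ℝ) ≤ ρ * A.ncard * ρ ^ L := by
    intro L
    calc ∑ l ∈ T L, ((B l).card : ℝ)
        ≤ (T L).card * ((2 / ((n - m : ℕ) : ℝ) ^ (k - 1)) ^ (L + 1) * A.ncard) := by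
          rw [← nsmul_eq_mul]; exact Finset.sum_le_card_nsmul _ _ _ (hB L)
      _ ≤ ((linkedPairs H).ncard * ((k : ℝ) ^ 2 * (n : ℝ) ^ (k - 2))) ^ (L + 1) *
            ((2 / ((n - m : ℕ) : ℝ) ^ (k - 1)) ^ (L + 1) * A.ncard) := by
          gcongr
          exact_mod_cast hTcard L
      _ = (2 * ((linkedPairs H).ncard *
            ((k : ℝ) ^ 2 * (n : ℝ) ^ (k - 2))) / ((n - m : ℕ) : ℝ) ^ (k - 1)) ^ (L + 1) *
            A.ncard := by
          rw [div_pow, div_pow, mul_pow 2]; ring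
      _ ≤ ρ ^ (L + 1) * A.ncard := by
          gcongr
          rwa [div_le_iff₀ hpos]
      _ = _ := by ring
  calc ({y ∈ A | HasClosedTrail H (fresh z y)}.ncard : ℝ)
      ≤ ((Finset.range (m + 1)).biUnion fun L => (T L).biUnion B).card := by
        rw [← Set.ncard_coe_finset]
        exact Nat.cast_le.2 (Set.ncard_le_ncard hsub)
    _ ≤ ∑ L ∈ Finset.range (m + 1), ∑ l ∈ T L, ((B l).card : ℝ) := by
        exact_mod_cast Finset.card_biUnion_le.trans
          (Finset.sum_le_sum fun L _ => Finset.card_biUnion_le)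
    _ ≤ ∑ L ∈ Finset.range (m + 1), ρ * A.ncard * ρ ^ L := Finset.sum_le_sum fun L _ => hL L
    _ ≤ ρ * A.ncard * 2 := by
        rw [← Finset.mul_sum]
        gcongr
        exact sum_range_pow_le_two hρ0 hρ _
    _ = _ := by ring

end Expectation

/-! ### Decomposition into global sets -/

section Decomposition

variable {k N : ℕ} {Λ : Type*}

theorem Subsumes.trans {z z' z'' : Labeling k N Λ} (h : Subsumes z'' z') (h' : Subsumes z' z) :
    Subsumes z'' z :=
  ⟨h'.1.trans h.1, fun e he => (h'.2 e he).trans (h.2 e (h'.1 he))⟩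

theorem Subsumes.OmegaRestrict_subset {z z' : Labeling k N Λ} (h : Subsumes z' z)
    (U : Fin k → Set Λ) (m : ℕ) : OmegaRestrict U m z' ⊆ OmegaRestrict U m z :=
  fun _ hy => ⟨hy.1, fun e he => (hy.2 e (h.1 he)).trans (h.2 e he).symm⟩

/-- If the density of `A`, discounted by a factor of `2` for each hyperedge, is maximal at `z'`
among the restrictions that subsume `z`, then the part of `A` given by `z'` is global. -/
theorem isGlobal_of_isMax [Finite Λ] {U : Fin k → Set Λ} {m : ℕ} {z z' : Labeling k N Λ}
    (A : Set (Labeling k N Λ)) (hz' : Subsumes z' z)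
    (hmax : ∀ w ∈ Restrictions N U m, Subsumes w z →
      density U m w A / 2 ^ (supp w).ncard ≤ density U m z' A / 2 ^ (supp z').ncard) :
    IsGlobal U m z' (A ∩ OmegaRestrict U m z') := by
  refine ⟨Set.inter_subset_right, fun w hw hwz => ?_⟩
  have h₁ : density U m w (A ∩ OmegaRestrict U m z') = density U m w A := by
    unfold density
    rw [Set.inter_assoc, Set.inter_eq_right.2 (hwz.OmegaRestrict_subset U m)]
  have h₂ : density U m z' (A ∩ OmegaRestrict U m z') = density U m z' A := by
    unfold density
    rw [Set.inter_assoc, Set.inter_self]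
  rw [h₁, h₂]
  have h := hmax w hw (hwz.trans hz')
  have hle : (supp z').ncard ≤ (supp w).ncard := Set.ncard_le_ncard hwz.1
  rw [div_le_iff₀ (by positivity)] at h
  rw [pow_sub₀ _ two_ne_zero hle]
  exact h.trans_eq (by ring)

/-- Every subset `A` of a restricted domain splits into global sets on which `f` is constant, and a
small rest. As long as some fibre of `f` in the rest is dense, the next piece is cut out by the
restriction that maximizes the discounted density of this fibre. -/
theorem exists_global_decomposition [NeZero N] [Finite Λ] {β : Type*} (f : Labeling k N Λ → β)
    (M : Finset β) {U : Fin k → Set Λ} {m : ℕ} {z : Labeling k N Λ}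
    (hz : z ∈ Restrictions N U m) {t : ℝ} (ht : 0 < t) (A : Set (Labeling k N Λ))
    (hA : A ⊆ OmegaRestrict U m z) (hf : ∀ y ∈ A, f y ∈ M) :
    ∃ 𝒟 : Finset (Labeling k N Λ × Set (Labeling k N Λ)),
      (∀ p ∈ 𝒟, p.1 ∈ Restrictions N U m ∧ Subsumes p.1 z ∧ IsGlobal U m p.1 p.2 ∧ p.2 ⊆ A ∧
        p.2.Nonempty ∧ (∃ b, ∀ y ∈ p.2, f y = b) ∧
        2 ^ ((supp p.1).ncard - (supp z).ncard) * t ≤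
          (p.2.ncard : ℝ) / (OmegaRestrict U m p.1).ncard) ∧
      (𝒟 : Set (Labeling k N Λ × Set (Labeling k N Λ))).PairwiseDisjoint Prod.snd ∧
      (A.ncard : ℝ) ≤ ∑ p ∈ 𝒟, (p.2.ncard : ℝ) + M.card * (t * (OmegaRestrict U m z).ncard) := by
  classical
  induction hcard : A.ncard using Nat.strong_induction_on generalizing A with
  | _ a ih =>
  by_cases hdense : ∃ b ∈ M, t ≤ density U m z {y ∈ A | f y = b}
  · obtain ⟨b, -, hb⟩ := hdense
    let B : Set (Labeling k N Λ) := {y ∈ A | f y = b}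
    obtain ⟨w, ⟨hw, hwz⟩, hmax⟩ := Set.exists_max_image
      {w | w ∈ Restrictions N U m ∧ Subsumes w z}
      (fun w => density U m w B / 2 ^ (supp w).ncard) (Set.toFinite _)
      ⟨z, hz, subset_rfl, fun _ _ => rfl⟩
    have hle : (supp z).ncard ≤ (supp w).ncard := Set.ncard_le_ncard hwz.1
    have hdens : 2 ^ ((supp w).ncard - (supp z).ncard) * t ≤ density U m w B := by
      have h := hmax z ⟨hz, subset_rfl, fun _ _ => rfl⟩
      rw [le_div_iff₀ (by positivity)] at h
      rw [pow_sub₀ _ two_ne_zero hle]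
      calc 2 ^ (supp w).ncard * (2 ^ (supp z).ncard)⁻¹ * t
          ≤ 2 ^ (supp w).ncard * (2 ^ (supp z).ncard)⁻¹ * density U m z B := by gcongr
        _ = density U m z B / 2 ^ (supp z).ncard * 2 ^ (supp w).ncard := by ring
        _ ≤ _ := h
    let A₁ := B ∩ OmegaRestrict U m w
    have hA₁A : A₁ ⊆ A := fun y hy => hy.1.1
    have hne : A₁.Nonempty := by
      by_contra h
      rw [Set.not_nonempty_iff_eq_empty] at h
      have h0 : density U m w B = 0 := by
        unfold density
        rw [show B ∩ OmegaRestrict U m w = ∅ from h]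
        simp
      rw [h0] at hdens
      exact absurd hdens (not_le.2 (by positivity))
    have hsplit : (A \ A₁).ncard + A₁.ncard = A.ncard := Set.ncard_sdiff_add_ncard_of_subset hA₁A
    have hpos : 0 < A₁.ncard := (Set.ncard_pos (Set.toFinite _)).2 hne
    obtain ⟨𝒟, h𝒟, hdisj, hsum⟩ := ih (A \ A₁).ncard (by omega) (A \ A₁)
      (Set.sdiff_subset.trans hA) (fun y hy => hf y hy.1) rfl
    have hfar : ∀ p ∈ 𝒟, Disjoint A₁ p.2 := fun p hp =>
      Set.disjoint_left.2 fun y hy hy' => ((h𝒟 p hp).2.2.2.1 hy').2 hy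
    have hnot : (w, A₁) ∉ 𝒟 := fun h => hne.ne_empty (disjoint_self.1 (hfar _ h))
    refine ⟨insert (w, A₁) 𝒟, ?_, ?_, ?_⟩
    · intro p hp
      rcases Finset.mem_insert.1 hp with rfl | hp
      · exact ⟨hw, hwz, isGlobal_of_isMax B hwz fun v hv hvz => hmax v ⟨hv, hvz⟩, hA₁A, hne,
          ⟨b, fun y hy => hy.1.2⟩, hdens⟩
      · obtain ⟨h₁, h₂, h₃, h₄, h₅⟩ := h𝒟 p hp
        exact ⟨h₁, h₂, h₃, h₄.trans Set.sdiff_subset, h₅⟩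
    · rw [Finset.coe_insert]
      exact hdisj.insert fun p hp _ => hfar p hp
    · rw [Finset.sum_insert hnot, ← hcard, ← hsplit]
      push_cast
      linarith
  · push Not at hdense
    refine ⟨∅, by simp, by simp, ?_⟩
    have hfib : ∀ b ∈ M, ((A.toFinite.toFinset.filter fun y => f y = b).card : ℝ) ≤
        t * (OmegaRestrict U m z).ncard := by
      intro b hb
      have h := hdense b hb
      have hsub : {y ∈ A | f y = b} ⊆ OmegaRestrict U m z := fun y hy => hA hy.1
      unfold density at h
      rw [Set.inter_eq_left.2 hsub] at h
      have hcoe : ((A.toFinite.toFinset.filter fun y => f y = b : Finset _) :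
          Set (Labeling k N Λ)) = {y ∈ A | f y = b} := by ext; simp
      rw [← Set.ncard_coe_finset, hcoe]
      rcases (OmegaRestrict U m z).ncard.eq_zero_or_pos with h0 | h0
      · have := Set.ncard_le_ncard hsub
        rw [h0, Nat.le_zero] at this
        simp [this, h0]
      · rw [div_lt_iff₀ (by exact_mod_cast h0)] at h
        exact h.le
    have hsum : (A.ncard : ℝ) =
        ∑ b ∈ M, ((A.toFinite.toFinset.filter fun y => f y = b).card : ℝ) := by
      rw [Set.ncard_eq_toFinset_card]
      exact_mod_cast Finset.card_eq_sum_card_fiberwise fun y hy =>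
        hf y ((Set.Finite.mem_toFinset _).1 hy)
    rw [Finset.sum_empty, zero_add, ← hcard, hsum, ← nsmul_eq_mul]
    exact Finset.sum_le_card_nsmul _ _ _ hfib

/-- There are fewer than `2 ^ (c + 1)` bit strings of length at most `c`. -/
theorem exists_finset_bitStrings (c : ℕ) :
    ∃ M : Finset (List Bool), (∀ l : List Bool, l.length ≤ c → l ∈ M) ∧
      M.card + 1 ≤ 2 ^ (c + 1) := by
  induction c with
  | zero => exact ⟨{[]}, by simp, by simp⟩
  | succ c ih =>
    obtain ⟨M, hM, hcard⟩ := ih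
    refine ⟨insert [] ((Finset.univ ×ˢ M).image fun p : Bool × List Bool => p.1 :: p.2), ?_, ?_⟩
    · rintro (_ | ⟨b, l⟩) hl
      · simp
      · exact Finset.mem_insert_of_mem (Finset.mem_image.2 ⟨(b, l),
          Finset.mem_product.2 ⟨Finset.mem_univ _, hM l (by simpa using hl)⟩, rfl⟩)
    · have h₁ := Finset.card_insert_le ([] : List Bool)
        ((Finset.univ ×ˢ M).image fun p : Bool × List Bool => p.1 :: p.2)
      have h₂ : ((Finset.univ ×ˢ M).image fun p : Bool × List Bool => p.1 :: p.2).card ≤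
          2 * M.card := Finset.card_image_le.trans (by simp)
      rw [pow_succ]
      omega

end Decomposition

/-! ### Structured rectangles -/

section Rectangles

variable {k : ℕ} {V E : Type*} {G : DistLabeledGraph k V E} {n K : ℕ} {α : ℝ}

theorem DistLabeledGraph.parts_disjoint (G : DistLabeledGraph k V E) (n : ℕ) (e : E) :
    Pairwise fun i j => Disjoint (G.parts n e i) (G.parts n e j) := by
  intro i j hij
  refine Set.disjoint_left.2 fun u hi hj => hij (G.edge_injective e ?_)
  exact (show u.1 = G.edge e i from hi).symm.trans hj

theorem DistLabeledGraph.ncard_parts (G : DistLabeledGraph k V E) (n : ℕ) (e : E) (i : Fin k) :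
    (G.parts n e i).ncard = n := by
  have : G.parts n e i = Prod.mk (G.edge e i) '' Set.univ := by
    ext ⟨v, t⟩
    simp [DistLabeledGraph.parts, eq_comm]
  rw [this, Set.ncard_image_of_injective _ (Prod.mk_right_injective _), Set.ncard_univ,
    Nat.card_eq_fintype_card, Fintype.card_fin]

theorem injective_of_mem_parts {G : DistLabeledGraph k V E} {e : E} {f : Fin k → V × Fin n}
    (hf : f ∈ Set.univ.pi (G.parts n e)) : Function.Injective f := by
  intro i j hij
  exact mem_part_unique (G.parts_disjoint n e) (hf i (Set.mem_univ i))
    (hij ▸ hf j (Set.mem_univ j))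

namespace StructuredRectangle

variable (R : StructuredRectangle G n K α)

theorem ncard_rect [Fintype E] : R.rect.ncard = ∏ p, (R.A p).ncard := by
  have e : R.rect ≃ ((p : E × Fin K) → R.A p) :=
    { toFun := fun Y p => ⟨Y.1 p, Y.2 p⟩
      invFun := fun Y => ⟨fun p => ⟨Y p, ((R.isGlobal p).1 (Y p).2).1⟩, fun p => (Y p).2⟩
      left_inv := fun _ => rfl
      right_inv := fun _ => rfl }
  rw [← Nat.card_coe_set_eq, Nat.card_congr e, Nat.card_pi]
  rfl

theorem rect_nonempty (h : ∀ p, (R.A p).Nonempty) : R.rect.Nonempty := by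
  choose y hy using h
  exact ⟨fun p => ⟨y p, ((R.isGlobal p).1 (hy p)).1⟩, hy⟩

theorem exists_mem_rect_apply_eq (h : R.rect.Nonempty) (p : E × Fin K) {y}
    (hy : y ∈ R.A p) : ∃ Y ∈ R.rect, (Y p : Labeling k G.N (V × Fin n)) = y := by
  classical
  obtain ⟨Y, hY⟩ := h
  refine ⟨Function.update Y p ⟨y, ((R.isGlobal p).1 hy).1⟩, fun q => ?_, by simp⟩
  by_cases hq : q = p
  · subst hq; simpa using hy
  · simpa [hq] using hY q

open Classical in
/-- The structured rectangle that arises from `R` if the restriction and the set of the player `p`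
are replaced. -/
noncomputable def replace (p : E × Fin K) (z : Labeling k G.N (V × Fin n))
    (A : Set (Labeling k G.N (V × Fin n)))
    (h : z ∈ Restrictions G.N (G.parts n p.1) ⌊α * n⌋₊ ∧
      IsGlobal (G.parts n p.1) ⌊α * n⌋₊ z A) :
    StructuredRectangle G n K α where
  z := Function.update R.z p z
  A := Function.update R.A p A
  z_mem q := by
    by_cases hq : q = p
    · subst hq; simpa using h.1
    · simpa [hq] using R.z_mem q
  isGlobal q := by
    by_cases hq : q = p
    · subst hq; simpa using h.2
    · simpa [hq] using R.isGlobal q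

section replace

variable {R} {p : E × Fin K} {z : Labeling k G.N (V × Fin n)}
  {A : Set (Labeling k G.N (V × Fin n))}
  {h : z ∈ Restrictions G.N (G.parts n p.1) ⌊α * n⌋₊ ∧ IsGlobal (G.parts n p.1) ⌊α * n⌋₊ z A}

@[simp] theorem replace_z_self : (R.replace p z A h).z p = z := by simp [replace]

@[simp] theorem replace_A_self : (R.replace p z A h).A p = A := by simp [replace]

theorem replace_z_of_ne {q : E × Fin K} (hq : q ≠ p) : (R.replace p z A h).z q = R.z q := by
  simp [replace, hq]

theorem replace_A_of_ne {q : E × Fin K} (hq : q ≠ p) : (R.replace p z A h).A q = R.A q := by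
  simp [replace, hq]

theorem ncard_rect_replace [Fintype E] [DecidableEq (E × Fin K)] :
    (R.replace p z A h).rect.ncard = A.ncard * ∏ q ∈ Finset.univ.erase p, (R.A q).ncard := by
  rw [ncard_rect, ← Finset.mul_prod_erase _ _ (Finset.mem_univ p), replace_A_self]
  congr 1
  exact Finset.prod_congr rfl fun q hq => by rw [replace_A_of_ne (Finset.ne_of_mem_erase hq)]

theorem edges_replace (hz : supp (R.z p) ⊆ supp z) :
    (R.replace p z A h).edges = R.edges ∪ fresh (R.z p) z := by
  ext e
  simp only [edges, Set.mem_iUnion, Set.mem_union, fresh, Set.mem_sdiff]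
  constructor
  · rintro ⟨q, hq⟩
    by_cases hqp : q = p
    · subst hqp
      rw [replace_z_self] at hq
      by_cases he : e ∈ supp (R.z q)
      · exact .inl ⟨q, he⟩
      · exact .inr ⟨hq, he⟩
    · rw [replace_z_of_ne hqp] at hq
      exact .inl ⟨q, hq⟩
  · rintro (⟨q, hq⟩ | ⟨he, -⟩)
    · by_cases hqp : q = p
      · subst hqp
        exact ⟨q, by rw [replace_z_self]; exact hz hq⟩
      · exact ⟨q, by rwa [replace_z_of_ne hqp]⟩
    · exact ⟨p, by rwa [replace_z_self]⟩

end replace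

/-- The densities of all sets of the structured rectangle in their restricted domains are at least
`2 ^ (-D)`. -/
def IsDense (D : ℕ) : Prop :=
  ∀ p, ((2 : ℝ) ^ D)⁻¹ ≤
    ((R.A p).ncard : ℝ) / (OmegaRestrict (G.parts n p.1) ⌊α * n⌋₊ (R.z p)).ncard

/-- The number of linked pairs, an upper bound for the weight of the restriction sequence. -/
noncomputable def linkedWeight : ℕ :=
  (linkedPairs R.edges).ncard

theorem weight_le_linkedWeight [Finite V] : R.weight ≤ R.linkedWeight :=
  componentWeight_le _

theorem A_nonempty_of_isDense {R : StructuredRectangle G n K α} {D : ℕ} (h : R.IsDense D)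
    (p : E × Fin K) : (R.A p).Nonempty := by
  by_contra h'
  rw [Set.not_nonempty_iff_eq_empty] at h'
  have := h p
  rw [h', Set.ncard_empty, Nat.cast_zero, zero_div] at this
  exact absurd this (not_le.2 (by positivity))

theorem fresh_subset_of_mem {R : StructuredRectangle G n K α} {p : E × Fin K}
    {z y : Labeling k G.N (V × Fin n)} {U : Fin k → Set (V × Fin n)} {m : ℕ}
    (hy : y ∈ OmegaRestrict U m z) : fresh (R.z p) z ⊆ fresh (R.z p) y := by
  rintro e ⟨he, he'⟩
  refine ⟨?_, he'⟩
  change y e ≠ none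
  rw [hy.2 e he]
  exact he

theorem replace_not_isCyclic [Finite V] (hk : 2 ≤ k) {R : StructuredRectangle G n K α}
    (hR : ¬ R.IsCyclic) {p : E × Fin K}
    {z : Labeling k G.N (V × Fin n)} {A : Set (Labeling k G.N (V × Fin n))}
    {h : z ∈ Restrictions G.N (G.parts n p.1) ⌊α * n⌋₊ ∧ IsGlobal (G.parts n p.1) ⌊α * n⌋₊ z A}
    (hz : supp (R.z p) ⊆ supp z) {y : Labeling k G.N (V × Fin n)} (hy : y ∈ A)
    (hclosed : ¬ HasClosedTrail R.edges (fresh (R.z p) y)) :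
    ¬ (R.replace p z A h).IsCyclic := by
  have hyz := h.2.1 hy
  have hS := fresh_subset_of_mem (R := R) (p := p) hyz
  have hinj : ∀ e ∈ fresh (R.z p) y, Function.Injective e := fun e he =>
    injective_of_mem_parts (hyz.1.1 he.1)
  unfold IsCyclic at hR ⊢
  push Not at hR ⊢
  obtain ⟨hpair, hcyc⟩ := hR
  refine ⟨?_, ?_⟩
  · have hdisj := disjoint_of_not_hasClosedTrail hk hinj hclosed
    have hp : ∀ q, q ≠ p → Disjoint (supp z) (supp (R.z q)) := by
      intro q hq
      refine Set.disjoint_left.2 fun e he heq => ?_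
      by_cases hep : e ∈ supp (R.z p)
      · exact Set.disjoint_left.1 (hpair hq) heq hep
      · exact Set.disjoint_left.1 hdisj (hS ⟨he, hep⟩) (Set.mem_iUnion.2 ⟨q, heq⟩)
    intro q q' hqq'
    by_cases hq : q = p
    · subst hq
      simp only [replace_z_self, replace_z_of_ne hqq'.symm]
      exact hp q' hqq'.symm
    · by_cases hq' : q' = p
      · subst hq'
        simp only [replace_z_self, replace_z_of_ne hq]
        exact (hp q hq).symm
      · simp only [replace_z_of_ne hq, replace_z_of_ne hq']
        exact hpair hqq'
  · rw [edges_replace hz]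
    exact not_hasCycle_union hk hcyc hinj (fresh_matching hyz.1) hclosed hS

end StructuredRectangle

end Rectangles

/-! ### One round of communication -/

section Round

variable {k : ℕ} {V E : Type*} {G : DistLabeledGraph k V E} {n K : ℕ} {α : ℝ}

namespace StructuredRectangle

/-- One round of communication: if the player `p` sends the message `f y` on the input `y`, then
a structured rectangle splits into structured rectangles on which the message is constant. What
is lost are the inputs outside the global pieces, a fraction of `2 ^ (-s)`, and the inputs that
close a trail, a fraction of `2 ρ`. The expected number of linked pairs grows by a constant factor
and by the number of prescribed hyperedges. -/
theorem exists_round [Finite V] [Fintype E] (hk : 2 ≤ k) (hm : ⌊α * n⌋₊ < n)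
    (R : StructuredRectangle G n K α) (hcyc : ¬ R.IsCyclic) {D : ℕ} (hD : R.IsDense D)
    (p : E × Fin K) (f : Labeling k G.N (V × Fin n) → List Bool) {c : ℕ}
    (hf : ∀ y ∈ R.A p, (f y).length ≤ c) (s : ℕ) {ρ : ℝ} (hρ0 : 0 ≤ ρ) (hρ : ρ ≤ 1 / 2)
    (hRρ : 2 * (R.linkedWeight * ((k : ℝ) ^ 2 * (n : ℝ) ^ (k - 2))) ≤
      ρ * ((n - ⌊α * n⌋₊ : ℕ) : ℝ) ^ (k - 1)) :
    ∃ 𝒬 : Finset (StructuredRectangle G n K α),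
      (∀ Q ∈ 𝒬, Q.rect ⊆ R.rect ∧ ¬ Q.IsCyclic ∧ Q.IsDense (D + (c + 1 + s)) ∧
        ∃ b, ∀ Y ∈ Q.rect, f (Y p) = b) ∧
      (𝒬 : Set (StructuredRectangle G n K α)).PairwiseDisjoint rect ∧
      (R.rect.ncard : ℝ) ≤
        ∑ Q ∈ 𝒬, (Q.rect.ncard : ℝ) + ((2 ^ s)⁻¹ + 2 * ρ) * R.rect.ncard ∧
      ∑ Q ∈ 𝒬, (Q.rect.ncard : ℝ) * Q.linkedWeight ≤
        (2 * ((k : ℝ) + 1) ^ 2 * R.linkedWeight + (k : ℝ) ^ 2 * (D + (c + 1 + s) : ℕ)) *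
          R.rect.ncard := by
  classical
  have : NeZero G.N := ⟨G.N_pos.ne'⟩
  set m := ⌊α * n⌋₊
  let U := G.parts n p.1
  let A := R.A p
  have hU : Pairwise fun i j => Disjoint (U i) (U j) := G.parts_disjoint n p.1
  have hn : ∀ i, (U i).ncard = n := G.ncard_parts n p.1
  have hA : IsGlobal U m (R.z p) A := R.isGlobal p
  have hk1 : 1 ≤ k := by omega
  obtain ⟨M, hM, hMcard⟩ := exists_finset_bitStrings c
  obtain ⟨𝒟, h𝒟, hdisj, hsum⟩ := exists_global_decomposition f M (R.z_mem p)
    (t := ((2 : ℝ) ^ (D + (c + 1 + s)))⁻¹) (by positivity) A hA.1 fun y hy => hM _ (hf y hy)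
  have hΩ : (((OmegaRestrict U m (R.z p)).ncard : ℝ)) ≤ 2 ^ D * A.ncard := by
    have h := hD p
    rcases (OmegaRestrict U m (R.z p)).ncard.eq_zero_or_pos with h0 | h0
    · rw [h0, Nat.cast_zero]; positivity
    · rw [le_div_iff₀ (by exact_mod_cast h0), inv_mul_le_iff₀ (by positivity)] at h
      exact h
  have hrest : (M.card : ℝ) * (((2 : ℝ) ^ (D + (c + 1 + s)))⁻¹ *
      (OmegaRestrict U m (R.z p)).ncard) ≤ (2 ^ s)⁻¹ * A.ncard := by
    have hM' : (M.card : ℝ) ≤ 2 ^ (c + 1) := by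
      exact_mod_cast (Nat.le_succ _).trans hMcard
    calc _ ≤ (2 : ℝ) ^ (c + 1) * (((2 : ℝ) ^ (D + (c + 1 + s)))⁻¹ * (2 ^ D * A.ncard)) := by
          gcongr
      _ = _ := by
          rw [pow_add 2 D, pow_add 2 (c + 1)]
          field_simp
  let g : Labeling k G.N (V × Fin n) × Set (Labeling k G.N (V × Fin n)) →
      StructuredRectangle G n K α := fun d =>
    if h : d.1 ∈ Restrictions G.N U m ∧ IsGlobal U m d.1 d.2 then R.replace p d.1 d.2 h else R
  have hg : ∀ d ∈ 𝒟, ∃ h, g d = R.replace p d.1 d.2 h := fun d hd =>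
    ⟨⟨(h𝒟 d hd).1, (h𝒟 d hd).2.2.1⟩, dif_pos _⟩
  have hgA : ∀ d ∈ 𝒟, (g d).A p = d.2 := fun d hd => by
    obtain ⟨h, hgd⟩ := hg d hd
    rw [hgd, replace_A_self]
  have hne : ∀ d ∈ 𝒟, d.2.Nonempty := fun d hd => (h𝒟 d hd).2.2.2.2.1
  have hginj : Set.InjOn g 𝒟 := by
    intro d hd d' hd' heq
    by_contra hdd'
    have h₂ : d.2 = d'.2 := by rw [← hgA d hd, heq, hgA d' hd']
    have := hdisj hd hd' hdd'
    rw [Function.onFun, h₂, disjoint_self] at this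
    exact (hne d' hd').ne_empty this
  let κ : ℝ := ∏ q ∈ Finset.univ.erase p, ((R.A q).ncard : ℝ)
  have hκ : 0 ≤ κ := by positivity
  have hgcard : ∀ d ∈ 𝒟, ((g d).rect.ncard : ℝ) = d.2.ncard * κ := by
    intro d hd
    obtain ⟨h, hgd⟩ := hg d hd
    rw [hgd, ncard_rect_replace]
    push_cast
    rfl
  have hRcard : (R.rect.ncard : ℝ) = A.ncard * κ := by
    rw [ncard_rect, ← Finset.mul_prod_erase _ _ (Finset.mem_univ p)]
    push_cast
    rfl
  -- sums over the inputs in the pieces are at most sums over the inputs in `A`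
  have hpieces : ∀ (𝒟' : Finset _) (B : Set (Labeling k G.N (V × Fin n)))
      (φ : Labeling k G.N (V × Fin n) → ℝ), 𝒟' ⊆ 𝒟 → (∀ d ∈ 𝒟', d.2 ⊆ B) → (∀ y, 0 ≤ φ y) →
      ∑ d ∈ 𝒟', ∑ y ∈ d.2.toFinite.toFinset, φ y ≤ ∑ y ∈ B.toFinite.toFinset, φ y := by
    intro 𝒟' B φ h𝒟' hB hφ
    rw [← Finset.sum_biUnion]
    · refine Finset.sum_le_sum_of_subset_of_nonneg ?_ fun y _ _ => hφ y
      intro y hy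
      obtain ⟨d, hd, hyd⟩ := Finset.mem_biUnion.1 hy
      exact (Set.Finite.mem_toFinset _).2 (hB d hd ((Set.Finite.mem_toFinset _).1 hyd))
    · intro d hd d' hd' hdd'
      refine Finset.disjoint_left.2 fun y hy hy' => ?_
      exact Set.disjoint_left.1 (hdisj (h𝒟' hd) (h𝒟' hd') hdd')
        ((Set.Finite.mem_toFinset _).1 hy) ((Set.Finite.mem_toFinset _).1 hy')
  let 𝒟₀ := 𝒟.filter fun d => ¬ (g d).IsCyclic
  have h𝒟₀ : 𝒟₀ ⊆ 𝒟 := Finset.filter_subset _ _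
  have hginj₀ : Set.InjOn g 𝒟₀ := hginj.mono (Finset.coe_subset.2 h𝒟₀)
  have hcyclic : ∑ d ∈ 𝒟.filter (fun d => (g d).IsCyclic), (d.2.ncard : ℝ) ≤
      2 * ρ * A.ncard := by
    have h := hpieces (𝒟.filter fun d => (g d).IsCyclic)
      {y ∈ A | HasClosedTrail R.edges (fresh (R.z p) y)} (fun _ => 1) (Finset.filter_subset _ _)
      (by
        intro d hd y hy
        obtain ⟨hd, hdc⟩ := Finset.mem_filter.1 hd
        refine ⟨(h𝒟 d hd).2.2.2.1 hy, ?_⟩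
        by_contra hclosed
        obtain ⟨h, hgd⟩ := hg d hd
        exact replace_not_isCyclic hk hcyc (h := h) (h𝒟 d hd).2.1.1 hy hclosed (hgd ▸ hdc))
      (fun _ => zero_le_one)
    simp only [Finset.sum_const, nsmul_eq_mul, mul_one, ← Set.ncard_eq_toFinset_card] at h
    exact h.trans (hA.ncard_hasClosedTrail_le hk1 hU hn hm R.edges hρ0 hρ hRρ)
  refine ⟨𝒟₀.image g, ?_, ?_, ?_, ?_⟩
  · intro Q hQ
    obtain ⟨d, hd₀, rfl⟩ := Finset.mem_image.1 hQ
    obtain ⟨hd, hdc⟩ := Finset.mem_filter.1 hd₀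
    obtain ⟨hd₁, hd₂, hd₃, hd₄, hd₅, ⟨b, hb⟩, hd₆⟩ := h𝒟 d hd
    obtain ⟨h, hgd⟩ := hg d hd
    refine ⟨?_, hdc, ?_, b, ?_⟩
    · intro Y hY q
      by_cases hq : q = p
      · subst hq
        exact hd₄ (hgA d hd ▸ hY q)
      · have := hY q
        rwa [hgd, replace_A_of_ne hq] at this
    · intro q
      rw [hgd]
      by_cases hq : q = p
      · subst hq
        rw [replace_A_self, replace_z_self]
        refine le_trans ?_ hd₆
        exact le_mul_of_one_le_left (by positivity) (one_le_pow₀ one_le_two)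
      · rw [replace_A_of_ne hq, replace_z_of_ne hq]
        refine le_trans ?_ (hD q)
        gcongr
        · exact one_le_two
        · omega
    · intro Y hY
      exact hb _ (hgA d hd ▸ hY p)
  · intro Q hQ Q' hQ' hQQ'
    obtain ⟨d, hd, rfl⟩ := Finset.mem_image.1 (Finset.mem_coe.1 hQ)
    obtain ⟨d', hd', rfl⟩ := Finset.mem_image.1 (Finset.mem_coe.1 hQ')
    refine Set.disjoint_left.2 fun Y hY hY' => ?_
    refine Set.disjoint_left.1 (hdisj (h𝒟₀ hd) (h𝒟₀ hd') fun h => hQQ' (h ▸ rfl))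
      (hgA d (h𝒟₀ hd) ▸ hY p) (hgA d' (h𝒟₀ hd') ▸ hY' p)
  · rw [Finset.sum_image hginj₀, Finset.sum_congr rfl fun d hd => hgcard d (h𝒟₀ hd),
      ← Finset.sum_mul, hRcard]
    have hsplit := Finset.sum_filter_add_sum_filter_not 𝒟 (fun d => (g d).IsCyclic)
      fun d => (d.2.ncard : ℝ)
    have : (A.ncard : ℝ) ≤ ∑ d ∈ 𝒟₀, (d.2.ncard : ℝ) + ((2 ^ s)⁻¹ + 2 * ρ) * A.ncard := by
      linarith
    calc (A.ncard : ℝ) * κ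
        ≤ (∑ d ∈ 𝒟₀, (d.2.ncard : ℝ) + ((2 ^ s)⁻¹ + 2 * ρ) * A.ncard) * κ := by gcongr
      _ = _ := by ring
  · let φ : Labeling k G.N (V × Fin n) → ℝ := fun y =>
      ((k : ℝ) + 1) ^ 2 * (mergedPairs R.edges (fresh (R.z p) y)).ncard +
        (k : ℝ) ^ 2 * (D + (c + 1 + s) : ℕ)
    have hφ : ∀ d ∈ 𝒟, ∀ y ∈ d.2, ((g d).linkedWeight : ℝ) ≤ φ y := by
      intro d hd y hy
      obtain ⟨-, hd₂, hd₃, hd₄, -, -, hd₆⟩ := h𝒟 d hd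
      obtain ⟨h, hgd⟩ := hg d hd
      have hyz := hd₃.1 hy
      have hle := ncard_linkedPairs_union_le (H := R.edges) (fresh_matching hyz.1)
        (fresh_subset_of_mem (R := R) (p := p) hyz)
      -- the density of a piece is at most one, which bounds the number of its hyperedges
      have hfresh : (fresh (R.z p) d.1).ncard ≤ D + (c + 1 + s) := by
        have hcardle : (d.2.ncard : ℝ) / (OmegaRestrict U m d.1).ncard ≤ 1 :=
          div_le_one_of_le₀ (by exact_mod_cast Set.ncard_le_ncard hd₃.1) (by positivity)
        have h1 := hd₆.trans hcardle
        rw [← div_eq_mul_inv, div_le_one (by positivity)] at h1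
        rw [fresh, Set.ncard_sdiff hd₂.1]
        exact (pow_le_pow_iff_right₀ one_lt_two).1 h1
      have hw : (g d).linkedWeight = (linkedPairs (R.edges ∪ fresh (R.z p) d.1)).ncard := by
        rw [hgd, linkedWeight, edges_replace hd₂.1]
      rw [hw]
      have := hle.trans (Nat.add_le_add_left (Nat.mul_le_mul_left (k ^ 2) hfresh) _)
      simp only [φ]
      exact_mod_cast this
    rw [Finset.sum_image hginj₀]
    calc ∑ d ∈ 𝒟₀, ((g d).rect.ncard : ℝ) * (g d).linkedWeight
        ≤ ∑ d ∈ 𝒟₀, (∑ y ∈ d.2.toFinite.toFinset, φ y) * κ := by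
          refine Finset.sum_le_sum fun d hd => ?_
          rw [hgcard d (h𝒟₀ hd), mul_right_comm]
          gcongr
          rw [Set.ncard_eq_toFinset_card d.2, ← nsmul_eq_mul]
          exact Finset.card_nsmul_le_sum _ _ _ fun y hy =>
            hφ d (h𝒟₀ hd) y ((Set.Finite.mem_toFinset _).1 hy)
      _ = (∑ d ∈ 𝒟₀, ∑ y ∈ d.2.toFinite.toFinset, φ y) * κ := by rw [Finset.sum_mul]
      _ ≤ (∑ y ∈ A.toFinite.toFinset, φ y) * κ := by
          gcongr
          exact hpieces 𝒟₀ A φ h𝒟₀ (fun d hd => (h𝒟 d (h𝒟₀ hd)).2.2.2.1) fun y => by positivity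
      _ = (((k : ℝ) + 1) ^ 2 * ∑ y ∈ A.toFinite.toFinset,
            ((mergedPairs R.edges (fresh (R.z p) y)).ncard : ℝ) +
            A.ncard * ((k : ℝ) ^ 2 * (D + (c + 1 + s) : ℕ))) * κ := by
          simp only [φ, Finset.sum_add_distrib, ← Finset.mul_sum, Finset.sum_const, nsmul_eq_mul,
            ← Set.ncard_eq_toFinset_card]
          ring
      _ ≤ (((k : ℝ) + 1) ^ 2 * (2 * R.linkedWeight * A.ncard) +
            A.ncard * ((k : ℝ) ^ 2 * (D + (c + 1 + s) : ℕ))) * κ := by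
          gcongr
          exact hA.sum_mergedPairs_le hk1 hU hn hm R.edges hρ0 hρ hRρ
      _ = _ := by rw [hRcard]; ring

end StructuredRectangle

end Round

/-! ### Induction on the protocol -/

section Protocols

variable {k : ℕ} {V E : Type*} {G : DistLabeledGraph k V E} {n K : ℕ} {α : ℝ}

theorem Protocol.eval_eq_of_bits_eq_zero {ι : Type*} {X : ι → Type*} (P : Protocol X)
    (h : ∀ Y, P.bits Y = 0) : ∃ a, ∀ Y, P.eval Y = a := by
  induction P with
  | output b => exact ⟨b, fun _ => rfl⟩
  | speak i msg next ih =>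
    have hmsg : ∀ Y : (i : ι) → X i, msg (Y i) = [] := fun Y => by
      have := h Y
      simp only [Protocol.bits] at this
      exact List.length_eq_zero_iff.1 (by omega)
    obtain ⟨a, ha⟩ := ih [] fun Y => by
      have := h Y
      simp only [Protocol.bits, hmsg Y] at this
      omega
    exact ⟨a, fun Y => by simp only [Protocol.eval, hmsg Y, ha]⟩

namespace StructuredRectangle

theorem IsDense.mono {R : StructuredRectangle G n K α} {D D' : ℕ} (h : R.IsDense D)
    (hD : D ≤ D') : R.IsDense D' := fun p =>
  (inv_anti₀ (by positivity) (pow_le_pow_right₀ one_le_two hD)).trans (h p)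

theorem IsDense.rect_nonempty {R : StructuredRectangle G n K α} {D : ℕ} (h : R.IsDense D) :
    R.rect.Nonempty :=
  R.rect_nonempty fun p => A_nonempty_of_isDense h p

theorem ncard_biUnion_rect [Finite V] [Finite E] (𝒬 : Finset (StructuredRectangle G n K α))
    (h : (𝒬 : Set (StructuredRectangle G n K α)).PairwiseDisjoint rect) :
    (⋃ Q ∈ 𝒬, Q.rect).ncard = ∑ Q ∈ 𝒬, Q.rect.ncard := by
  classical
  induction 𝒬 using Finset.induction_on with
  | empty => simp
  | insert Q 𝒬 hQ ih =>
    rw [Finset.coe_insert] at h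
    rw [Finset.sum_insert hQ, Finset.set_biUnion_insert, Set.ncard_union_eq,
      ih (h.subset (Set.subset_insert _ _))]
    refine Set.disjoint_left.2 fun Y hY hY' => ?_
    obtain ⟨Q', hQ', hY'⟩ := Set.mem_iUnion₂.1 hY'
    exact Set.disjoint_left.1 (h (Set.mem_insert _ _) (Set.mem_insert_of_mem _ hQ')
      fun heq => hQ (heq ▸ hQ')) hY hY'

/-- The growth factor `2 (k + 1) ^ 2` of the expected number of linked pairs in one round. -/
noncomputable def growth (k : ℕ) : ℝ :=
  2 * ((k : ℝ) + 1) ^ 2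

/-- The factor in the bound for the probability that one round closes a trail. -/
noncomputable def closing (k : ℕ) (α : ℝ) : ℝ :=
  4 * (k : ℝ) ^ 2 / (1 - α) ^ (k - 1)

theorem one_le_growth (k : ℕ) : 1 ≤ growth k := by
  unfold growth
  nlinarith [(Nat.cast_nonneg k : (0 : ℝ) ≤ k)]

theorem closing_nonneg {α : ℝ} (hα : α < 1) : 0 ≤ closing k α := by
  have : 0 < 1 - α := sub_pos.2 hα
  unfold closing
  positivity

/-- The estimate of one round with explicit dependence on the number of linked pairs. If this
number is too large, then the claimed bound for the lost part is trivial. -/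
theorem exists_round_of_linkedWeight [Finite V] [Fintype E] (hk : 2 ≤ k)
    (hα : α ∈ Set.Ioo (0 : ℝ) 1)
    (hn : 0 < n) (R : StructuredRectangle G n K α) (hcyc : ¬ R.IsCyclic) {D : ℕ}
    (hD : R.IsDense D) (p : E × Fin K) (f : Labeling k G.N (V × Fin n) → List Bool) {c : ℕ}
    (hf : ∀ y ∈ R.A p, (f y).length ≤ c) (s : ℕ) :
    ∃ 𝒬 : Finset (StructuredRectangle G n K α),
      (∀ Q ∈ 𝒬, Q.rect ⊆ R.rect ∧ ¬ Q.IsCyclic ∧ Q.IsDense (D + (c + 1 + s)) ∧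
        ∃ b, ∀ Y ∈ Q.rect, f (Y p) = b) ∧
      (𝒬 : Set (StructuredRectangle G n K α)).PairwiseDisjoint rect ∧
      (R.rect.ncard : ℝ) ≤ ∑ Q ∈ 𝒬, (Q.rect.ncard : ℝ) +
        ((2 ^ s)⁻¹ + closing k α / n * R.linkedWeight) * R.rect.ncard ∧
      ∑ Q ∈ 𝒬, (Q.rect.ncard : ℝ) * Q.linkedWeight ≤
        growth k * (R.linkedWeight + (D + (c + 1 + s) : ℕ)) * R.rect.ncard := by
  have hα1 : 0 < 1 - α := sub_pos.2 hα.2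
  have hn' : (0 : ℝ) < n := by exact_mod_cast hn
  have hfloor : ((⌊α * n⌋₊ : ℕ) : ℝ) ≤ α * n :=
    Nat.floor_le (mul_nonneg hα.1.le hn'.le)
  have hm : ⌊α * n⌋₊ < n := by
    have : ((⌊α * n⌋₊ : ℕ) : ℝ) < n := hfloor.trans_lt (by nlinarith [hα.2])
    exact_mod_cast this
  set ρ : ℝ := closing k α / n * R.linkedWeight / 2 with hρ_def
  have hρ2 : closing k α / n * R.linkedWeight = 2 * ρ := by rw [hρ_def]; ring
  have hclose := closing_nonneg (k := k) hα.2
  have hρ0 : 0 ≤ ρ := by positivity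
  rw [hρ2]
  by_cases hρ : ρ ≤ 1 / 2
  · have hRρ : 2 * (R.linkedWeight * ((k : ℝ) ^ 2 * (n : ℝ) ^ (k - 2))) ≤
        ρ * ((n - ⌊α * n⌋₊ : ℕ) : ℝ) ^ (k - 1) := by
      have hsub : (1 - α) * n ≤ ((n - ⌊α * n⌋₊ : ℕ) : ℝ) := by
        rw [Nat.cast_sub hm.le]; linarith
      calc 2 * (R.linkedWeight * ((k : ℝ) ^ 2 * (n : ℝ) ^ (k - 2)))
          = ρ * ((1 - α) * n) ^ (k - 1) := by
            have hpow : (n : ℝ) ^ (k - 1) = n ^ (k - 2) * n := by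
              rw [← pow_succ]; congr 1; omega
            rw [hρ_def, closing, mul_pow, hpow]
            field_simp
            ring
        _ ≤ _ := by gcongr
    obtain ⟨𝒬, h₁, h₂, h₃, h₄⟩ := exists_round hk hm R hcyc hD p f hf s hρ0 hρ hRρ
    refine ⟨𝒬, h₁, h₂, h₃, h₄.trans ?_⟩
    gcongr
    unfold growth
    rw [mul_add]
    gcongr
    nlinarith [(Nat.cast_nonneg k : (0 : ℝ) ≤ k)]
  · refine ⟨∅, by simp, by simp, ?_, ?_⟩
    · rw [Finset.sum_empty, zero_add]
      refine le_mul_of_one_le_left (by positivity) ?_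
      have : (0 : ℝ) < (2 ^ s)⁻¹ := by positivity
      push Not at hρ
      linarith
    · rw [Finset.sum_empty]
      have := one_le_growth k
      positivity

/-- The decomposition for a whole protocol, by induction on the number `r` of rounds. Here
`c` bounds the length of the messages, `2 ^ (-s)` is the loss allowed for in the decomposition of
a single round, and `W` bounds the number of bits of density that are lost in total. -/
theorem exists_decomposition [Finite V] [Fintype E] (hk : 2 ≤ k) (hα : α ∈ Set.Ioo (0 : ℝ) 1)
    (hn : 0 < n) (c s W : ℕ) (P : Protocol fun p : E × Fin K => G.Input n α p.1) :
    ∀ (r D : ℕ) (R : StructuredRectangle G n K α), ¬ R.IsCyclic → R.IsDense D →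
      D + r * (c + 1 + s) ≤ W → (∀ Y ∈ R.rect, P.rounds Y ≤ r ∧ P.bits Y ≤ c) →
    ∃ 𝒬 : Finset (StructuredRectangle G n K α),
      (∀ Q ∈ 𝒬, Q.rect ⊆ R.rect ∧ ¬ Q.IsCyclic ∧ Q.IsDense W ∧
        ∃ a, ∀ Y ∈ Q.rect, P.eval Y = a) ∧
      (𝒬 : Set (StructuredRectangle G n K α)).PairwiseDisjoint rect ∧
      (R.rect.ncard : ℝ) ≤ ∑ Q ∈ 𝒬, (Q.rect.ncard : ℝ) +
        (r * (2 ^ s)⁻¹ + closing k α / n * (r * growth k ^ r * (R.linkedWeight + r * W))) *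
          R.rect.ncard ∧
      ∑ Q ∈ 𝒬, (Q.rect.ncard : ℝ) * Q.linkedWeight ≤
        growth k ^ r * (R.linkedWeight + r * W) * R.rect.ncard := by
  classical
  have hC := one_le_growth k
  have hb : 0 ≤ closing k α / n := div_nonneg (closing_nonneg hα.2) (Nat.cast_nonneg n)
  induction P with
  | output b =>
    intro r D R hcyc hD hW _
    refine ⟨{R}, ?_, by simp, ?_, ?_⟩
    · intro Q hQ
      rw [Finset.mem_singleton.1 hQ]
      exact ⟨subset_rfl, hcyc, hD.mono (by omega), b, fun _ _ => rfl⟩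
    · rw [Finset.sum_singleton]
      refine le_add_of_nonneg_right ?_
      positivity
    · rw [Finset.sum_singleton, mul_comm]
      gcongr
      calc (R.linkedWeight : ℝ) ≤ 1 * (R.linkedWeight + r * W) := by
            rw [one_mul]; exact le_add_of_nonneg_right (by positivity)
        _ ≤ _ := by gcongr; exact one_le_pow₀ hC
  | speak p msg next ih =>
    intro r D R hcyc hD hW hR
    have hne := hD.rect_nonempty
    obtain ⟨Y₀, hY₀⟩ := hne
    obtain ⟨r, rfl⟩ : ∃ r', r = r' + 1 := by
      refine Nat.exists_eq_succ_of_ne_zero fun h => ?_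
      have := (hR Y₀ hY₀).1
      simp only [Protocol.rounds, h] at this
      omega
    -- the message as a function of labeled matchings
    let f : Labeling k G.N (V × Fin n) → List Bool := fun y =>
      if h : y ∈ Omega G.N (G.parts n p.1) ⌊α * n⌋₊ then msg ⟨y, h⟩ else []
    have hf : ∀ y : G.Input n α p.1, f y = msg y := fun y => by
      simp only [f]
      rw [dif_pos y.2]
    have hflen : ∀ y ∈ R.A p, (f y).length ≤ c := by
      intro y hy
      obtain ⟨Y, hY, rfl⟩ := R.exists_mem_rect_apply_eq ⟨Y₀, hY₀⟩ p hy
      have := (hR Y hY).2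
      simp only [Protocol.bits] at this
      rw [hf]
      omega
    obtain ⟨𝒬, h𝒬, hdisj, hloss, hweight⟩ :=
      exists_round_of_linkedWeight hk hα hn R hcyc hD p f hflen s
    have hstep : ∀ Q ∈ 𝒬, ∃ 𝒬' : Finset (StructuredRectangle G n K α),
        (∀ Q' ∈ 𝒬', Q'.rect ⊆ Q.rect ∧ ¬ Q'.IsCyclic ∧ Q'.IsDense W ∧
          ∃ a, ∀ Y ∈ Q'.rect, (Protocol.speak p msg next).eval Y = a) ∧
        (𝒬' : Set (StructuredRectangle G n K α)).PairwiseDisjoint rect ∧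
        (Q.rect.ncard : ℝ) ≤ ∑ Q' ∈ 𝒬', (Q'.rect.ncard : ℝ) +
          (r * (2 ^ s)⁻¹ + closing k α / n * (r * growth k ^ r * (Q.linkedWeight + r * W))) *
            Q.rect.ncard ∧
        ∑ Q' ∈ 𝒬', (Q'.rect.ncard : ℝ) * Q'.linkedWeight ≤
          growth k ^ r * (Q.linkedWeight + r * W) * Q.rect.ncard := by
      intro Q hQ
      obtain ⟨hQR, hQcyc, hQD, b, hb⟩ := h𝒬 Q hQ
      have hmsg : ∀ Y ∈ Q.rect, msg (Y p) = b := fun Y hY => by rw [← hf, hb Y hY]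
      obtain ⟨𝒬', h₁, h₂⟩ := ih b r _ Q hQcyc hQD (by rw [add_mul] at hW; omega) (by
        intro Y hY
        have := hR Y (hQR hY)
        simp only [Protocol.rounds, Protocol.bits, hmsg Y hY] at this
        omega)
      refine ⟨𝒬', fun Q' hQ' => ?_, h₂⟩
      obtain ⟨h₃, h₄, h₅, a, ha⟩ := h₁ Q' hQ'
      exact ⟨h₃, h₄, h₅, a, fun Y hY => by
        simp only [Protocol.eval, hmsg Y (h₃ hY), ha Y hY]⟩
    choose! F hF hFdisj hFloss hFweight using hstep
    have hFF : (𝒬 : Set (StructuredRectangle G n K α)).PairwiseDisjoint F := by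
      intro Q hQ Q' hQ' hQQ'
      refine Finset.disjoint_left.2 fun S hS hS' => ?_
      obtain ⟨Y, hY⟩ := (hF Q hQ S hS).2.2.1.rect_nonempty
      exact Set.disjoint_left.1 (hdisj hQ hQ' hQQ') ((hF Q hQ S hS).1 hY) ((hF Q' hQ' S hS').1 hY)
    have hle : ∑ Q ∈ 𝒬, (Q.rect.ncard : ℝ) ≤ R.rect.ncard := by
      rw [← Nat.cast_sum, ← ncard_biUnion_rect 𝒬 hdisj]
      exact_mod_cast Set.ncard_le_ncard (Set.iUnion₂_subset fun Q hQ => (h𝒬 Q hQ).1)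
    have hDW : ((D + (c + 1 + s) : ℕ) : ℝ) ≤ W := by
      refine Nat.cast_le.2 (le_trans ?_ hW)
      rw [add_mul]
      omega
    set C := growth k
    set w : ℝ := (R.linkedWeight : ℝ)
    set x : ℝ := (R.rect.ncard : ℝ)
    have hx : 0 ≤ x := Nat.cast_nonneg _
    have hw : 0 ≤ w := Nat.cast_nonneg _
    have hWnn : (0 : ℝ) ≤ W := Nat.cast_nonneg _
    have hCr : 1 ≤ C ^ r := one_le_pow₀ hC
    have havg : ∑ Q ∈ 𝒬, (Q.rect.ncard : ℝ) * (Q.linkedWeight + r * W) ≤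
        C * (w + (r + 1) * W) * x := by
      calc ∑ Q ∈ 𝒬, (Q.rect.ncard : ℝ) * (Q.linkedWeight + r * W)
          = ∑ Q ∈ 𝒬, (Q.rect.ncard : ℝ) * Q.linkedWeight +
            (∑ Q ∈ 𝒬, (Q.rect.ncard : ℝ)) * (r * W) := by
            simp only [mul_add, Finset.sum_add_distrib, Finset.sum_mul]
        _ ≤ C * (w + W) * x + x * (r * W) := by
            gcongr
            exact hweight.trans (by gcongr)
        _ ≤ C * (w + W) * x + C * (x * (r * W)) := by
            have := le_mul_of_one_le_left (b := x * (r * W)) (by positivity) hC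
            linarith
        _ = _ := by ring
    refine ⟨𝒬.biUnion F, ?_, ?_, ?_, ?_⟩
    · intro S hS
      obtain ⟨Q, hQ, hS⟩ := Finset.mem_biUnion.1 hS
      obtain ⟨h₁, h₂⟩ := hF Q hQ S hS
      exact ⟨h₁.trans (h𝒬 Q hQ).1, h₂⟩
    · intro S hS S' hS' hSS'
      obtain ⟨Q, hQ, hS⟩ := Finset.mem_biUnion.1 (Finset.mem_coe.1 hS)
      obtain ⟨Q', hQ', hS'⟩ := Finset.mem_biUnion.1 (Finset.mem_coe.1 hS')
      by_cases hQQ' : Q = Q'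
      · subst hQQ'
        exact hFdisj Q hQ hS hS' hSS'
      · exact (hdisj hQ hQ' hQQ').mono (hF Q hQ S hS).1 (hF Q' hQ' S' hS').1
    · rw [Finset.sum_biUnion hFF]
      have h₁ : ∑ Q ∈ 𝒬, (Q.rect.ncard : ℝ) ≤ ∑ Q ∈ 𝒬, ∑ Q' ∈ F Q, (Q'.rect.ncard : ℝ) +
          (r * (2 ^ s)⁻¹ * x + closing k α / n * (r * C ^ r * (C * (w + (r + 1) * W) * x))) := by
        calc ∑ Q ∈ 𝒬, (Q.rect.ncard : ℝ)
            ≤ ∑ Q ∈ 𝒬, (∑ Q' ∈ F Q, (Q'.rect.ncard : ℝ) +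
              (r * (2 ^ s)⁻¹ + closing k α / n * (r * C ^ r * (Q.linkedWeight + r * W))) *
                Q.rect.ncard) := Finset.sum_le_sum hFloss
          _ = ∑ Q ∈ 𝒬, ∑ Q' ∈ F Q, (Q'.rect.ncard : ℝ) +
              (r * (2 ^ s)⁻¹ * ∑ Q ∈ 𝒬, (Q.rect.ncard : ℝ) + closing k α / n * (r * C ^ r *
                ∑ Q ∈ 𝒬, (Q.rect.ncard : ℝ) * (Q.linkedWeight + r * W))) := by
              simp only [Finset.mul_sum, ← Finset.sum_add_distrib]
              exact Finset.sum_congr rfl fun Q _ => by ring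
          _ ≤ _ := by gcongr
      have h₂ : closing k α / n * w * x ≤
          closing k α / n * (C ^ (r + 1) * (w + (r + 1) * W) * x) := by
        rw [mul_assoc]
        gcongr
        calc w ≤ 1 * (w + (r + 1) * W) := by
              rw [one_mul]; exact le_add_of_nonneg_right (by positivity)
          _ ≤ _ := by gcongr; exact one_le_pow₀ hC
      push_cast
      calc x ≤ _ := hloss
        _ ≤ ∑ Q ∈ 𝒬, ∑ Q' ∈ F Q, (Q'.rect.ncard : ℝ) +
            (r * (2 ^ s)⁻¹ * x + closing k α / n * (r * C ^ r * (C * (w + (r + 1) * W) * x))) +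
            ((2 ^ s)⁻¹ * x + closing k α / n * (C ^ (r + 1) * (w + (r + 1) * W) * x)) := by
          rw [add_mul]
          exact add_le_add h₁ (by gcongr)
        _ = _ := by ring
    · rw [Finset.sum_biUnion hFF]
      push_cast
      calc ∑ Q ∈ 𝒬, ∑ Q' ∈ F Q, (Q'.rect.ncard : ℝ) * Q'.linkedWeight
          ≤ ∑ Q ∈ 𝒬, C ^ r * (Q.linkedWeight + r * W) * Q.rect.ncard :=
            Finset.sum_le_sum hFweight
        _ = C ^ r * ∑ Q ∈ 𝒬, (Q.rect.ncard : ℝ) * (Q.linkedWeight + r * W) := by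
            rw [Finset.mul_sum]
            exact Finset.sum_congr rfl fun Q _ => by ring
        _ ≤ C ^ r * (C * (w + (r + 1) * W) * x) := by gcongr
        _ = _ := by ring

end StructuredRectangle

end Protocols

/-! ### The rectangle of all inputs -/

section FullRectangle

variable {k : ℕ} {V E : Type*} (G : DistLabeledGraph k V E) (n K : ℕ) (α : ℝ)

theorem Omega_nonempty (hk : 1 ≤ k) (e : E) {m : ℕ} (hm : m ≤ n) :
    (Omega G.N (G.parts n e) m).Nonempty := by
  classical
  -- the first `m` of the `n` parallel copies of `e`
  let S : Set (Fin k → V × Fin n) := (fun t i => (G.edge e i, t)) '' {t : Fin n | t.1 < m}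
  have hS : supp (fun f => if f ∈ S then some 0 else none : Labeling k G.N (V × Fin n)) = S := by
    ext f
    simp [supp]
  have hinj : Function.Injective fun (t : Fin n) (i : Fin k) => (G.edge e i, t) := fun t t' h =>
    (Prod.mk.inj (congrFun h ⟨0, hk⟩)).2
  refine ⟨fun f => if f ∈ S then some 0 else none, ?_, ?_, ?_, ?_⟩
  · rw [hS]
    rintro _ ⟨t, -, rfl⟩ i -
    rfl
  · rw [hS, isMatching_iff]
    rintro _ ⟨t, -, rfl⟩ _ ⟨t', -, rfl⟩ x ⟨i, rfl⟩ ⟨j, hj⟩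
    rw [(Prod.mk.inj hj).2]
  · rw [hS]
    exact Set.toFinite _
  · rw [hS, Set.ncard_image_of_injective _ hinj]
    have : {t : Fin n | t.1 < m} = Set.range (Fin.castLE hm) := by
      ext t
      exact ⟨fun h => ⟨⟨t, h⟩, rfl⟩, by rintro ⟨s, rfl⟩; exact s.2⟩
    rw [this, ← Set.image_univ, Set.ncard_image_of_injective _ (Fin.castLE_injective hm)]
    simp

theorem OmegaRestrict_none {k N : ℕ} {Λ : Type*} (U : Fin k → Set Λ) (m : ℕ) :
    OmegaRestrict U m (fun _ => none : Labeling k N Λ) = Omega N U m := by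
  ext y
  simp [OmegaRestrict, supp]

/-- The structured rectangle of all joint inputs, without any prescribed hyperedges. -/
def fullRectangle [Finite V] (hk : 1 ≤ k) (hm : ⌊α * n⌋₊ ≤ n) : StructuredRectangle G n K α where
  z _ := fun _ => none
  A p := Omega G.N (G.parts n p.1) ⌊α * n⌋₊
  z_mem p := ⟨0, Nat.zero_le _, by simp [Omega, IsMatching, supp]⟩
  isGlobal p := by
    have : NeZero G.N := ⟨G.N_pos.ne'⟩
    refine ⟨(OmegaRestrict_none _ _).ge, fun z' _ _ => ?_⟩
    have h₁ : density (G.parts n p.1) ⌊α * n⌋₊ z' (Omega G.N (G.parts n p.1) ⌊α * n⌋₊) ≤ 1 :=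
      div_le_one_of_le₀ (Nat.cast_le.2 (Set.ncard_le_ncard Set.inter_subset_right))
        (Nat.cast_nonneg _)
    have h₂ : density (G.parts n p.1) ⌊α * n⌋₊ (fun _ => none)
        (Omega G.N (G.parts n p.1) ⌊α * n⌋₊) = 1 := by
      unfold density
      rw [OmegaRestrict_none, Set.inter_self]
      refine div_self (Nat.cast_ne_zero.2 ?_)
      exact ((Set.ncard_pos (Set.toFinite _)).2 (Omega_nonempty G n hk p.1 hm)).ne'
    rw [h₂, mul_one]
    exact h₁.trans (one_le_pow₀ one_le_two)

variable {G n K α} [Finite V] {hk : 1 ≤ k} {hm : ⌊α * n⌋₊ ≤ n}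

theorem rect_fullRectangle : (fullRectangle G n K α hk hm).rect = Set.univ :=
  Set.eq_univ_of_forall fun Y p => (Y p).2

theorem edges_fullRectangle : (fullRectangle G n K α hk hm).edges = ∅ := by
  simp [StructuredRectangle.edges, fullRectangle, supp]

theorem not_isCyclic_fullRectangle : ¬ (fullRectangle G n K α hk hm).IsCyclic := by
  rintro (h | ⟨F, hF, hsub, -⟩)
  · exact h fun p q _ => by simp [fullRectangle, supp]
  · rw [edges_fullRectangle] at hsub
    obtain ⟨e, he⟩ := hF
    exact hsub he

theorem isDense_fullRectangle : (fullRectangle G n K α hk hm).IsDense 0 := by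
  have : NeZero G.N := ⟨G.N_pos.ne'⟩
  intro p
  change _ ≤ ((Omega G.N (G.parts n p.1) ⌊α * n⌋₊).ncard : ℝ) /
    (OmegaRestrict (G.parts n p.1) ⌊α * n⌋₊ (fun _ => none : Labeling k G.N _)).ncard
  rw [OmegaRestrict_none, div_self, pow_zero, inv_one]
  refine Nat.cast_ne_zero.2 ?_
  exact ((Set.ncard_pos (Set.toFinite _)).2 (Omega_nonempty G n hk p.1 hm)).ne'

theorem linkedWeight_fullRectangle : (fullRectangle G n K α hk hm).linkedWeight = 0 := by
  have : linkedPairs (∅ : Set (Fin k → V × Fin n)) = ∅ := by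
    ext p
    simp [linkedPairs, cover]
  rw [StructuredRectangle.linkedWeight, edges_fullRectangle, this, Set.ncard_empty]

end FullRectangle

section Conclusion

variable {k : ℕ} {V E : Type*} {G : DistLabeledGraph k V E} {n K : ℕ} {α : ℝ}

open StructuredRectangle

theorem isGood_of_isDense [Finite V] {R : StructuredRectangle G n K α} {W : ℕ} {θ : ℝ}
    (hcyc : ¬ R.IsCyclic) (hW : R.IsDense W) (hWθ : (W : ℝ) ≤ θ) (hθ : (R.linkedWeight : ℝ) ≤ θ) :
    R.IsGood θ θ := by
  refine ⟨hcyc, fun p => le_trans ?_ (hW p), ?_⟩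
  · rw [← Real.rpow_natCast, ← Real.rpow_neg zero_le_two]
    exact Real.rpow_le_rpow_of_exponent_le one_le_two (neg_le_neg hWθ)
  · exact le_trans (Nat.cast_le.2 R.weight_le_linkedWeight) hθ

/-- The accumulated bound for the expected number of linked pairs is at most exponential in the
number `r` of rounds, where `r + 10` stands for the number of bits that one round may lose apart
from the message. The constant is `104 = 13 * 2 ^ 3`. -/
theorem rounds_mul_le {C : ℝ} (hC : 1 ≤ C) {r c : ℕ} (hc : 1 ≤ c) (hr : 1 ≤ r) :
    C ^ r * (r * ((r * (c + 1 + (r + 10)) : ℕ) : ℝ)) ≤ c * (104 * C) ^ r := by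
  have h₁ : r * (r * (c + 1 + (r + 10))) ≤ c * 104 ^ r := by
    have h2 : r ≤ 2 ^ r := Nat.lt_two_pow_self.le
    have h13 : 13 ≤ 13 ^ r := Nat.le_self_pow (by omega) 13
    calc r * (r * (c + 1 + (r + 10))) ≤ r * (r * (13 * r * c)) := by
          gcongr
          nlinarith
      _ = c * (13 * (r * r * r)) := by ring
      _ ≤ c * (13 ^ r * (2 ^ r * 2 ^ r * 2 ^ r)) := by gcongr
      _ = c * 104 ^ r := by rw [← mul_pow, ← mul_pow, ← mul_pow]; norm_num
  calc C ^ r * (r * ((r * (c + 1 + (r + 10)) : ℕ) : ℝ))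
      = C ^ r * ((r * (r * (c + 1 + (r + 10))) : ℕ) : ℝ) := by push_cast; ring
    _ ≤ C ^ r * ((c * 104 ^ r : ℕ) : ℝ) := by gcongr
    _ = _ := by push_cast; rw [mul_pow]; ring

end Conclusion

end DIHP

open DIHP DIHP.StructuredRectangle in
theorem mainTheorem11 {k : ℕ} (hk : 2 ≤ k) {V E : Type*} [Finite V] [Finite E]
    (G : DIHP.DistLabeledGraph k V E) (K : ℕ) (hK : 0 < K) (α : ℝ) (hα : α ∈ Set.Ioo (0 : ℝ) 1) :
    ∃ η₁ ∈ Set.Ioo (0 : ℝ) 1, ∃ η₂ ∈ Set.Ioo (0 : ℝ) 1,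
      ∀ (n r : ℕ) (P : DIHP.Protocol fun p : E × Fin K => G.Input n α p.1),
        P.IsRound r → (P.cost : ℝ) ≤ η₁ ^ r * (n : ℝ) →
        ∃ 𝓡 : Set (DIHP.StructuredRectangle G n K α),
          𝓡.PairwiseDisjoint DIHP.StructuredRectangle.rect ∧
          0.99 ≤ G.probNo n K α (⋃ R ∈ 𝓡, R.rect) ∧
          (∀ R ∈ 𝓡, R.IsGood ((η₂ ^ r)⁻¹ * (P.cost : ℝ)) ((η₂ ^ r)⁻¹ * (P.cost : ℝ))) ∧
          ∀ R ∈ 𝓡, ∃ a : Bool, ∀ Y ∈ R.rect, P.eval Y = a := by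
  classical
  have : Fintype E := Fintype.ofFinite E
  have hk1 : 1 ≤ k := by omega
  set C : ℝ := growth k
  set b : ℝ := closing k α
  have hC : 1 ≤ C := one_le_growth k
  have hb : 0 ≤ b := closing_nonneg hα.2
  -- `104 * C` to the power `r` bounds the expected number of linked pairs per bit of the cost, a
  -- further factor `2` absorbs the sum over the rounds, and `1000` leaves room for small losses
  have hη₁ : 0 < 208000 * C * (b + 1) := by positivity
  have hη₂ : 0 < 104000 * C := by positivity
  refine ⟨(208000 * C * (b + 1))⁻¹, ⟨inv_pos.2 hη₁, inv_lt_one_of_one_lt₀ (by nlinarith)⟩,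
    (104000 * C)⁻¹, ⟨inv_pos.2 hη₂, inv_lt_one_of_one_lt₀ (by nlinarith)⟩, ?_⟩
  intro n r P hP hcost
  have hfloor : ((⌊α * n⌋₊ : ℕ) : ℝ) ≤ α * n :=
    Nat.floor_le (mul_nonneg hα.1.le (Nat.cast_nonneg n))
  have hm : ⌊α * n⌋₊ ≤ n := by
    have : ((⌊α * n⌋₊ : ℕ) : ℝ) ≤ n :=
      hfloor.trans (mul_le_of_le_one_left (Nat.cast_nonneg n) hα.2.le)
    exact_mod_cast this
  let R₀ := fullRectangle G n K α hk1 hm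
  have hR₀ : R₀.rect = Set.univ := rect_fullRectangle
  have hne : Nonempty (G.JointInput n K α) :=
    ⟨(isDense_fullRectangle (hk := hk1) (hm := hm)).rect_nonempty.some⟩
  have hcard : 0 < (Nat.card (G.JointInput n K α) : ℝ) := Nat.cast_pos.2 Nat.card_pos
  rcases P.cost.eq_zero_or_pos with hc0 | hc
  · -- a silent protocol has constant output
    obtain ⟨a, ha⟩ := P.eval_eq_of_bits_eq_zero fun Y =>
      Nat.le_zero.1 (hc0 ▸ P.bits_le_cost Y)
    refine ⟨{R₀}, by simp, ?_, ?_, fun R _ => ⟨a, fun Y _ => ha Y⟩⟩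
    · simp only [Set.mem_singleton_iff, Set.iUnion_iUnion_eq_left, hR₀, DistLabeledGraph.probNo,
        Set.ncard_univ]
      rw [div_self hcard.ne']
      norm_num
    · rintro R rfl
      rw [hc0, Nat.cast_zero, mul_zero]
      exact isGood_of_isDense not_isCyclic_fullRectangle isDense_fullRectangle (by simp)
        (by rw [linkedWeight_fullRectangle]; simp)
  have hr : 1 ≤ r := by
    by_contra hr
    obtain rfl : r = 0 := by omega
    cases P with
    | output b => simp [Protocol.cost, Protocol.bits] at hc
    | speak i msg next =>
      have := hP hne.some
      simp [Protocol.rounds] at this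
  have hn : 0 < n := by
    rcases n.eq_zero_or_pos with rfl | h
    · rw [Nat.cast_zero, mul_zero] at hcost
      have : (0 : ℝ) < P.cost := Nat.cast_pos.2 hc
      linarith
    · exact h
  have hn' : (0 : ℝ) < n := Nat.cast_pos.2 hn
  set c := P.cost
  set W := r * (c + 1 + (r + 10))
  have hX := rounds_mul_le hC hc hr
  obtain ⟨𝒬, h𝒬, hdisj, hloss, hweight⟩ := exists_decomposition hk hα hn c (r + 10) W P r 0 R₀
    not_isCyclic_fullRectangle isDense_fullRectangle (by omega)
    fun Y _ => ⟨hP Y, P.bits_le_cost Y⟩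
  have hw₀ : R₀.linkedWeight = 0 := linkedWeight_fullRectangle
  rw [hw₀, Nat.cast_zero, zero_add] at hloss hweight
  set x : ℝ := (R₀.rect.ncard : ℝ) with hx_def
  have hx : x = Nat.card (G.JointInput n K α) := by rw [hx_def, hR₀, Set.ncard_univ]
  have hx0 : 0 < x := hx ▸ hcard
  have hc' : (0 : ℝ) < c := Nat.cast_pos.2 hc
  set θ : ℝ := (((104000 * C)⁻¹) ^ r)⁻¹ * (c : ℝ) with hθ_def
  have hθ : θ = c * (104000 * C) ^ r := by
    rw [hθ_def, inv_pow, inv_inv, mul_comm]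
  have hθ0 : 0 < θ := by rw [hθ]; positivity
  have hthousand : (1000 : ℝ) ≤ 1000 ^ r := le_self_pow₀ (by norm_num) (by omega)
  have hXθ : c * (104 * C) ^ r ≤ θ / 1000 := by
    rw [hθ, le_div_iff₀ (by norm_num), show 104000 * C = (104 * C) * 1000 by ring, mul_pow _ 1000,
      ← mul_assoc]
    gcongr
  have hWθ : (W : ℝ) ≤ θ := by
    have hr' : (1 : ℝ) ≤ r := by exact_mod_cast hr
    calc (W : ℝ) ≤ C ^ r * (r * W) := by
          rw [← mul_assoc]
          exact le_mul_of_one_le_left (Nat.cast_nonneg _)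
            (one_le_mul_of_one_le_of_one_le (one_le_pow₀ hC) hr')
      _ ≤ c * (104 * C) ^ r := hX
      _ ≤ θ / 1000 := hXθ
      _ ≤ θ := by linarith
  have hpow2 : (r : ℝ) ≤ 2 ^ r := by exact_mod_cast Nat.lt_two_pow_self.le
  -- the loss in the decompositions of the single rounds
  have hloss₁ : (r : ℝ) * (2 ^ (r + 10))⁻¹ ≤ 1 / 1000 := by
    rw [← div_eq_mul_inv, div_le_iff₀ (by positivity), pow_add]
    nlinarith
  -- the loss from closed trails
  have hloss₂ : b / n * (r * C ^ r * (r * W)) ≤ 1 / 1000 := by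
    calc b / n * (r * C ^ r * (r * W)) = b / n * (r * (C ^ r * (r * W))) := by ring
      _ ≤ b / n * (2 ^ r * (c * (104 * C) ^ r)) := by gcongr
      _ ≤ b / n * (2 ^ r * (((208000 * C * (b + 1))⁻¹ ^ r * n) * (104 * C) ^ r)) := by gcongr
      _ = b * ((208000 * C * (b + 1))⁻¹ * (2 * (104 * C))) ^ r := by
          rw [mul_pow _ (2 * (104 * C)), mul_pow 2 (104 * C)]
          field_simp
      _ = b * ((1000 * (b + 1))⁻¹) ^ r := by
          congr 2
          field_simp
          norm_num
      _ ≤ b * (1000 * (b + 1))⁻¹ := by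
          gcongr
          exact pow_le_of_le_one (by positivity) (inv_le_one_of_one_le₀ (by linarith)) (by omega)
      _ ≤ 1 / 1000 := by
          rw [← div_eq_mul_inv, div_le_div_iff₀ (by positivity) (by norm_num)]
          linarith
  let 𝒬₁ := 𝒬.filter fun Q => (Q.linkedWeight : ℝ) ≤ θ
  have h𝒬₁ : 𝒬₁ ⊆ 𝒬 := Finset.filter_subset _ _
  have hdisj₁ : (𝒬₁ : Set (StructuredRectangle G n K α)).PairwiseDisjoint rect :=
    hdisj.subset (Finset.coe_subset.2 h𝒬₁)
  -- Markov's inequality for the number of linked pairs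
  have hmarkov : ∑ Q ∈ 𝒬.filter (fun Q => ¬ (Q.linkedWeight : ℝ) ≤ θ), (Q.rect.ncard : ℝ) ≤
      1 / 1000 * x := by
    refine le_of_mul_le_mul_right ?_ hθ0
    calc (∑ Q ∈ 𝒬.filter (fun Q => ¬ (Q.linkedWeight : ℝ) ≤ θ), (Q.rect.ncard : ℝ)) * θ
        ≤ ∑ Q ∈ 𝒬.filter (fun Q => ¬ (Q.linkedWeight : ℝ) ≤ θ),
            (Q.rect.ncard : ℝ) * Q.linkedWeight := by
          rw [Finset.sum_mul]
          refine Finset.sum_le_sum fun Q hQ => ?_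
          have := (not_le.1 (Finset.mem_filter.1 hQ).2).le
          gcongr
      _ ≤ ∑ Q ∈ 𝒬, (Q.rect.ncard : ℝ) * Q.linkedWeight :=
          Finset.sum_le_sum_of_subset_of_nonneg (Finset.filter_subset _ _)
            fun _ _ _ => by positivity
      _ ≤ C ^ r * (r * W) * x := hweight
      _ ≤ θ / 1000 * x := by gcongr; exact hX.trans hXθ
      _ = _ := by ring
  refine ⟨𝒬₁, hdisj₁, ?_, ?_, ?_⟩
  · have hsplit := Finset.sum_filter_add_sum_filter_not 𝒬
      (fun Q => (Q.linkedWeight : ℝ) ≤ θ) fun Q => (Q.rect.ncard : ℝ)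
    have hunion : ((⋃ Q ∈ (𝒬₁ : Set (StructuredRectangle G n K α)), Q.rect).ncard : ℝ) =
        ∑ Q ∈ 𝒬₁, (Q.rect.ncard : ℝ) := by
      have := ncard_biUnion_rect 𝒬₁ hdisj₁
      simp only [Finset.mem_coe]
      exact_mod_cast this
    have hle : (r * (2 ^ (r + 10))⁻¹ + b / n * (r * C ^ r * (r * W))) * x ≤ 2 / 1000 * x := by
      gcongr
      linarith
    rw [DistLabeledGraph.probNo, hunion, ← hx, le_div_iff₀ hx0]
    have h99 : (0.99 : ℝ) * x = x - 2 / 1000 * x - 8 / 1000 * x := by norm_num; ring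
    rw [h99]
    have hloss' := hloss.trans (add_le_add_right hle _)
    linarith
  · intro Q hQ
    obtain ⟨hQ, hQθ⟩ := Finset.mem_filter.1 (Finset.mem_coe.1 hQ)
    obtain ⟨-, hQcyc, hQW, -⟩ := h𝒬 Q hQ
    exact isGood_of_isDense hQcyc hQW hWθ hQθ
  · intro Q hQ
    exact (h𝒬 Q (h𝒬₁ hQ)).2.2.2
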